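/- Let $X$ be a nonempty countable set and let $b:X\times X\to[0,\infty)$ satisfy $b(x,x)=0$, $b(x,y)=b(y,x)$ and $\sum_{z\in X}b(x,z)<\infty$ for all $x,y\in X$. Let $\mu:X\to(0,\infty)$ and $V:X\to\mathbb R$. All functions are real-valued; $C_c(X)$ denotes the functions of finite support and $\ell^2(X,\mu)$ the Hilbert space of functions with $\sum_x f(x)^2\mu(x)<\infty$, with $\langle f,g\rangle=\sum_x f(x)g(x)\mu(x)$. Let $$\mathcal Hf(x)=\frac1{\mu(x)}\sum_{y\in X}b(x,y)(f(x)-f(y))+V(x)f(x),\qquad f\in\mathcal F=\Big\{f:\sum_y b(x,y)|f(y)|<\infty\text{ for all }x\in X\Big\}.$$ Quadratic forms on $\ell^2(X,\mu)$ take values in $(-\infty,\infty]$, and $D(q)=\{f: q(f)<\infty\}$. The form of a lower semi-bounded self-adjoint operator $H$ is the densely defined, lower semi-bounded, closed quadratic form $q$ such that $f\in D(H)$ and $Hf=g$ if and only if $f\in D(q)$ and $q(f,h)=\langle g,h\rangle$ for all $h\in D(q)$. A realization of $\mathcal H$ is a self-adjoint operator $H$ on $\ell^2(X,\mu)$ that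 is semi-bounded from below, whose form has a domain containing $C_c(X)$, and for which $D(H)\subseteq\mathcal F$ and $Hf=\mathcal Hf$ for all $f\in D(H)$. It is Markovian if its form $q$ is a Dirichlet form, that is, a nonnegative densely defined closed quadratic form such that $C\circ f\in D(q)$ and $q(C\circ f)\le q(f)$ for all $f\in D(q)$ and all $C:\mathbb R\to\mathbb R$ with $C(0)=0$ and $|C(s)-C(t)|\le|s-t|$. Let $\mathcal D$ be the set of all $f:X\to\mathbb R$ with $\sum_{x,y}b(x,y)(f(x)-f(y))^2+\sum_x|V(x)|f(x)^2\mu(x)<\infty$, and for $f\in\mathcal D$ let $$\mathcal Q(f)=\frac12\sum_{x,y\in X}b(x,y)(f(x)-f(y))^2+\sum_{x\in X}V(x)f(x)^2\mu(x).$$ For $V\ge0$ the restriction of $\mathcal Q$ to $C_c(X)$ is closable on $\ell^2(X,\mu)$; let $Q^0$ be its closure, and let $Q^{(N)}$ be the restriction of $\mathcal Q$ to $\mathcal D\cap\ell^2(X,\mu)$. Then $\mathcal H$ has exactly one Markovian realization if and only if $V\ge0$ and $Q^0=Q^{(N)}$ (same domain and same values). -/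

import Mathlib

open Filter Topology

namespace DiscreteSchrodinger

/-- A symmetric weighted graph on the vertex set `X`. -/
structure WeightedGraph (X : Type*) where
  /-- the edge weight -/
  b : X → X → ℝ
  nonneg : ∀ x y, 0 ≤ b x y
  diag : ∀ x, b x x = 0
  symm : ∀ x y, b x y = b y x
  summable : ∀ x, Summable (fun z => b x z)

/-- A weight, that is, a strictly positive function on `X`. -/
structure Weight (X : Type*) where
  /-- the mass of a point -/
  toFun : X → ℝ
  pos : ∀ x, 0 < toFun x

instance {X : Type*} : CoeFun (Weight X) (fun _ => X → ℝ) := ⟨Weight.toFun⟩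

variable {X : Type*}

/-! ### The Hilbert space of real-valued square summable functions -/

theorem summable_mul_of_sq (μ : Weight X) {f g : X → ℝ}
    (hf : Summable (fun x => f x ^ 2 * μ x)) (hg : Summable (fun x => g x ^ 2 * μ x)) :
    Summable (fun x => f x * g x * μ x) := by
  refine Summable.of_norm_bounded (hf.add hg) (fun x => ?_)
  have h := (μ.pos x).le
  rw [Real.norm_eq_abs, abs_mul, abs_of_nonneg h, ← add_mul]
  refine mul_le_mul_of_nonneg_right ?_ h
  rw [abs_mul]
  nlinarith [sq_nonneg (|f x| - |g x|), sq_abs (f x), sq_abs (g x), sq_nonneg (f x),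
    sq_nonneg (g x)]

/-- The functions `f : X → ℝ` with `∑ x, f x ^ 2 * μ x < ∞`, as a subspace. -/
def ell2Submodule (μ : Weight X) : Submodule ℝ (X → ℝ) where
  carrier := {f | Summable (fun x => f x ^ 2 * μ x)}
  zero_mem' := by simp
  add_mem' := by
    intro f g hf hg
    have h := (hf.add hg).add ((summable_mul_of_sq μ hf hg).mul_left 2)
    refine h.congr (fun x => ?_)
    simp only [Pi.add_apply]
    ring
  smul_mem' := by
    intro c f hf
    refine (hf.mul_left (c ^ 2)).congr (fun x => ?_)
    simp only [Pi.smul_apply, smul_eq_mul]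
    ring

/-- The space of real-valued square summable functions with respect to `μ`.  (A separate type, so
that it carries the topology of its norm and not that of pointwise convergence.) -/
def Ell2 (μ : Weight X) : Type _ := ↥(ell2Submodule μ)

namespace Ell2

variable {μ : Weight X}

instance : AddCommGroup (Ell2 μ) := inferInstanceAs (AddCommGroup ↥(ell2Submodule μ))

instance : Module ℝ (Ell2 μ) := inferInstanceAs (Module ℝ ↥(ell2Submodule μ))

instance : CoeFun (Ell2 μ) (fun _ => X → ℝ) := ⟨fun f => f.1⟩

/-- The element of `Ell2 μ` given by a square summable function. -/
def mk (f : X → ℝ) (hf : Summable (fun x => f x ^ 2 * μ x)) : Ell2 μ := ⟨f, hf⟩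

theorem mk_apply (f : X → ℝ) (hf : Summable (fun x => f x ^ 2 * μ x)) (x : X) :
    (mk f hf : Ell2 μ) x = f x := rfl

theorem summable_sq (f : Ell2 μ) : Summable (fun x => f x ^ 2 * μ x) := f.2

@[ext] theorem ext {f g : Ell2 μ} (h : ∀ x, f x = g x) : f = g := Subtype.ext (funext h)

theorem add_apply (f g : Ell2 μ) (x : X) : (f + g) x = f x + g x := rfl

theorem sub_apply (f g : Ell2 μ) (x : X) : (f - g) x = f x - g x := rfl

theorem smul_apply (c : ℝ) (f : Ell2 μ) (x : X) : (c • f) x = c * f x := rfl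

theorem zero_apply (x : X) : (0 : Ell2 μ) x = 0 := rfl

theorem summable_mul (f g : Ell2 μ) : Summable (fun x => f x * g x * μ x) :=
  summable_mul_of_sq μ f.2 g.2

/-- The inner product `⟪f, g⟫ = ∑ x, f x * g x * μ x`. -/
noncomputable instance core : InnerProductSpace.Core ℝ (Ell2 μ) where
  inner f g := ∑' x, f x * g x * μ x
  conj_inner_symm f g := by
    simp only [conj_trivial]
    exact tsum_congr (fun x => by ring)
  re_inner_nonneg f := by
    simp only [RCLike.re_to_real]
    exact tsum_nonneg (fun x => mul_nonneg (mul_self_nonneg _) (μ.pos x).le)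
  add_left f g h := by
    rw [← (summable_mul f h).tsum_add (summable_mul g h)]
    exact tsum_congr (fun x => by rw [add_apply]; ring)
  smul_left f g c := by
    simp only [conj_trivial]
    rw [← tsum_mul_left]
    exact tsum_congr (fun x => by rw [smul_apply]; ring)
  definite f hf := by
    have h0 : ∀ x, 0 ≤ f x * f x * μ x := fun x => mul_nonneg (mul_self_nonneg _) (μ.pos x).le
    have h1 := ((summable_mul f f).hasSum_iff.2 hf)
    have h2 := (hasSum_zero_iff_of_nonneg h0).1 h1
    ext x
    have h3 := congrFun h2 x
    simp only [Pi.zero_apply, mul_eq_zero, or_self] at h3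
    rcases h3 with h3 | h3
    · exact h3
    · exact absurd h3 (μ.pos x).ne'

noncomputable instance : NormedAddCommGroup (Ell2 μ) :=
  InnerProductSpace.Core.toNormedAddCommGroup (𝕜 := ℝ)

noncomputable instance : InnerProductSpace ℝ (Ell2 μ) :=
  InnerProductSpace.ofCore (core (μ := μ)).toCore

theorem inner_def (f g : Ell2 μ) : inner ℝ f g = ∑' x, f x * g x * μ x := rfl

theorem norm_sq_def (f : Ell2 μ) : ‖f‖ ^ 2 = ∑' x, f x ^ 2 * μ x := by
  rw [← real_inner_self_eq_norm_sq, inner_def]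
  exact tsum_congr (fun x => by ring)

instance : CompleteSpace (Ell2 μ) := by
  have hmem : ∀ f : Ell2 μ, Memℓp (fun x => Real.sqrt (μ x) * f x) 2 := by
    intro f
    refine memℓp_gen (f.summable_sq.congr (fun x => ?_))
    have h := Real.sq_sqrt (μ.pos x).le
    simp only [ENNReal.toReal_ofNat, Real.rpow_ofNat, Real.norm_eq_abs, sq_abs, mul_pow, h]
    ring
  let T : Ell2 μ →ₗ[ℝ] lp (fun _ : X => ℝ) 2 :=
    { toFun := fun f => ⟨fun x => Real.sqrt (μ x) * f x, hmem f⟩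
      map_add' := fun f g => by
        ext x
        change Real.sqrt (μ x) * (f x + g x) = Real.sqrt (μ x) * f x + Real.sqrt (μ x) * g x
        ring
      map_smul' := fun c f => by
        ext x
        change Real.sqrt (μ x) * (c * f x) = c * (Real.sqrt (μ x) * f x)
        ring }
  have hT : ∀ f x, (T f : X → ℝ) x = Real.sqrt (μ x) * f x := fun _ _ => rfl
  have hnorm : ∀ f, ‖T f‖ = ‖f‖ := by
    intro f
    have h1 : ‖T f‖ ^ 2 = ‖f‖ ^ 2 := by
      rw [← real_inner_self_eq_norm_sq, norm_sq_def, lp.inner_eq_tsum]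
      refine tsum_congr (fun x => ?_)
      rw [hT, real_inner_self_eq_norm_sq, Real.norm_eq_abs, sq_abs, mul_pow,
        Real.sq_sqrt (μ.pos x).le]
      ring
    exact (sq_eq_sq₀ (norm_nonneg _) (norm_nonneg _)).1 h1
  let Ti : Ell2 μ →ₗᵢ[ℝ] lp (fun _ : X => ℝ) 2 := ⟨T, hnorm⟩
  have hsurj : Function.Surjective Ti := by
    intro g
    have hg := (memℓp_gen_iff (p := 2) (by norm_num)).1 g.2
    refine ⟨mk (fun x => (Real.sqrt (μ x))⁻¹ * (g : X → ℝ) x) (hg.congr (fun x => ?_)), ?_⟩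
    · have h := Real.sq_sqrt (μ.pos x).le
      have h' := (μ.pos x).ne'
      simp only [ENNReal.toReal_ofNat, Real.rpow_ofNat, Real.norm_eq_abs, sq_abs, mul_pow, inv_pow,
        h]
      field_simp
    · ext x
      change Real.sqrt (μ x) * ((Real.sqrt (μ x))⁻¹ * (g : X → ℝ) x) = (g : X → ℝ) x
      rw [mul_inv_cancel_left₀ (Real.sqrt_pos.2 (μ.pos x)).ne']
  exact (LinearIsometryEquiv.ofSurjective Ti hsurj).toIsometryEquiv.completeSpace_iff.2
    inferInstance

/-- The composition of `f` with a map `C` that satisfies `|C t| ≤ |t|`. -/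
def comp (C : ℝ → ℝ) (hC : ∀ t, |C t| ≤ |t|) (f : Ell2 μ) : Ell2 μ :=
  mk (fun x => C (f x)) (Summable.of_nonneg_of_le
    (fun x => mul_nonneg (sq_nonneg _) (μ.pos x).le)
    (fun x => mul_le_mul_of_nonneg_right (sq_le_sq.2 (hC (f x))) (μ.pos x).le) f.summable_sq)

end Ell2

/-! ### Quadratic forms on a real Hilbert space

Quadratic forms take values in `(-∞, ∞]`, realized as the extended reals different from `⊥`; the
domain of `q` is the set of all `f` with `q f ≠ ⊤`. -/

section Forms

variable {E : Type*} [NormedAddCommGroup E] [InnerProductSpace ℝ E]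

/-- `q : E → (-∞, ∞]` is homogeneous and satisfies the parallelogram identity. -/
structure IsQuadraticForm (q : E → EReal) : Prop where
  ne_bot : ∀ f, q f ≠ ⊥
  smul : ∀ (c : ℝ) (f : E), q (c • f) = ((c ^ 2 : ℝ) : EReal) * q f
  parallelogram : ∀ f g : E, q (f + g) + q (f - g) = 2 * q f + 2 * q g

/-- The domain of a form. -/
def formDomain (q : E → EReal) : Set E := {f | q f ≠ ⊤}

/-- The bilinear form on the domain of `q` obtained by polarization. -/
noncomputable def polarForm (q : E → EReal) (f g : E) : ℝ :=
  ((q (f + g)).toReal - (q (f - g)).toReal) / 4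

/-- The form `q` is semi-bounded from below. -/
def IsLowerSemibounded (q : E → EReal) : Prop :=
  ∃ C : ℝ, ∀ f, ((C * ‖f‖ ^ 2 : ℝ) : EReal) ≤ q f

/-- The sequence `u` in the domain of `q` is Cauchy with respect to the form norm
`(q f + (α - lam) * ‖f‖ ^ 2) ^ (1 / 2)`, where `α > 0` and `lam` is the largest lower bound of `q`.
For a lower semi-bounded form this means that it is Cauchy in the Hilbert space and that
`q (u m - u n) → 0`. -/
def IsFormCauchy (q : E → EReal) (u : ℕ → E) : Prop :=
  (∀ n, u n ∈ formDomain q) ∧ CauchySeq u ∧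
    Tendsto (fun p : ℕ × ℕ => q (u p.1 - u p.2)) atTop (𝓝 0)

/-- A densely defined lower semi-bounded quadratic form whose domain is complete with respect to
the form norm. -/
structure IsClosedForm (q : E → EReal) : Prop where
  isQuadraticForm : IsQuadraticForm q
  dense : Dense (formDomain q)
  lowerSemibounded : IsLowerSemibounded q
  complete : ∀ u : ℕ → E, IsFormCauchy q u →
    ∃ f ∈ formDomain q, Tendsto u atTop (𝓝 f) ∧ Tendsto (fun n => q (u n - f)) atTop (𝓝 0)

/-- The closure of a (closable) form `q`, obtained by completion: `f` belongs to its domain if `f`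
is the limit in `E` of a form-Cauchy sequence `u` of `q`, and then its value at `f` is the limit of
`q (u n)`.  For closable `q` this limit does not depend on `u`, so that the infimum is taken over
at most one number; it is `⊤` if there is no such sequence. -/
noncomputable def formClosure (q : E → EReal) (f : E) : EReal :=
  sInf {c | ∃ u : ℕ → E, IsFormCauchy q u ∧ Tendsto u atTop (𝓝 f) ∧
    Tendsto (fun n => q (u n)) atTop (𝓝 c)}

/-- The operator `H` is semi-bounded from below. -/
def IsSemiboundedOperator (H : E →ₗ.[ℝ] E) : Prop :=
  ∃ C : ℝ, ∀ f : H.domain, C * ‖(f : E)‖ ^ 2 ≤ inner ℝ (H f) (f : E)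

/-- `q` is the quadratic form associated with the operator `H` (and `H` is the operator associated
with `q`): `q` is a densely defined lower semi-bounded closed form, and `f` belongs to the domain
of `H` with `H f = g` if and only if `f` belongs to the domain of `q` and `q(f, h) = ⟪g, h⟫` for
all `h` in the domain of `q`.  Every lower semi-bounded self-adjoint operator has exactly one such
form. -/
structure IsFormOf (q : E → EReal) (H : E →ₗ.[ℝ] E) : Prop where
  closed : IsClosedForm q
  mem_graph_iff : ∀ f g : E, (f, g) ∈ H.graph ↔
    f ∈ formDomain q ∧ ∀ h ∈ formDomain q, polarForm q f h = inner ℝ g h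

end Forms

/-- A normal contraction of the real line. -/
structure IsNormalContraction (C : ℝ → ℝ) : Prop where
  map_zero : C 0 = 0
  abs_sub_le : ∀ s t, |C s - C t| ≤ |s - t|

theorem IsNormalContraction.abs_le {C : ℝ → ℝ} (hC : IsNormalContraction C) (t : ℝ) :
    |C t| ≤ |t| := by
  simpa [hC.map_zero] using hC.abs_sub_le t 0

/-- A Dirichlet form: a nonnegative densely defined closed form on which normal contractions
operate. -/
structure IsDirichletForm {μ : Weight X} (q : Ell2 μ → EReal) : Prop where
  closed : IsClosedForm q
  nonneg : ∀ f, 0 ≤ q f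
  contraction : ∀ (C : ℝ → ℝ) (hC : IsNormalContraction C) (f : Ell2 μ),
    f ∈ formDomain q → Ell2.comp C hC.abs_le f ∈ formDomain q ∧ q (Ell2.comp C hC.abs_le f) ≤ q f

/-! ### The formal Schrödinger operator and its Markovian realizations -/

/-- The domain of the formal operator: `∑ y, b x y * |f y| < ∞` for all `x`. -/
def formalDomain (G : WeightedGraph X) : Set (X → ℝ) :=
  {f | ∀ x, Summable (fun y => G.b x y * |f y|)}

/-- The formal Schrödinger operator with potential `V`. -/
noncomputable def formalOperator (G : WeightedGraph X) (μ : Weight X) (V : X → ℝ) (f : X → ℝ)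
    (x : X) : ℝ :=
  (μ x)⁻¹ * ∑' y, G.b x y * (f x - f y) + V x * f x

/-- The finitely supported functions, as a subset of the Hilbert space. -/
def finSupp (μ : Weight X) : Set (Ell2 μ) := {f | (Function.support (fun x => f x)).Finite}

/-- A self-adjoint operator `H` is a realization of the formal Schrödinger operator if it is
semi-bounded from below, the domain of its quadratic form contains the finitely supported
functions, and it is a restriction of the formal operator. -/
structure IsRealization (G : WeightedGraph X) (μ : Weight X) (V : X → ℝ)
    (H : Ell2 μ →ₗ.[ℝ] Ell2 μ) : Prop where
  selfAdjoint : IsSelfAdjoint H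
  semibounded : IsSemiboundedOperator H
  finSupp_subset : ∃ q, IsFormOf q H ∧ finSupp μ ⊆ formDomain q
  mem_formalDomain : ∀ f : H.domain, (fun x => (f : Ell2 μ) x) ∈ formalDomain G
  apply_eq : ∀ (f : H.domain) (x : X),
    (H f) x = formalOperator G μ V (fun y => (f : Ell2 μ) y) x

/-- A realization whose quadratic form is a Dirichlet form. -/
def IsMarkovianRealization (G : WeightedGraph X) (μ : Weight X) (V : X → ℝ)
    (H : Ell2 μ →ₗ.[ℝ] Ell2 μ) : Prop :=
  IsRealization G μ V H ∧ ∃ q, IsFormOf q H ∧ IsDirichletForm q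

/-! ### The Schrödinger form, `Q⁰` and `Q⁽ᴺ⁾` -/

/-- The functions of finite energy. -/
def finiteEnergy (G : WeightedGraph X) (μ : Weight X) (V : X → ℝ) : Set (X → ℝ) :=
  {f | Summable (fun p : X × X => G.b p.1 p.2 * (f p.1 - f p.2) ^ 2) ∧
    Summable (fun x => |V x| * f x ^ 2 * μ x)}

/-- The Schrödinger form, on the functions of finite energy. -/
noncomputable def energy (G : WeightedGraph X) (μ : Weight X) (V : X → ℝ) (f : X → ℝ) : ℝ :=
  1 / 2 * ∑' p : X × X, G.b p.1 p.2 * (f p.1 - f p.2) ^ 2 + ∑' x, V x * f x ^ 2 * μ x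

open Classical in
/-- The Schrödinger form restricted to the finitely supported functions. -/
noncomputable def Qc (G : WeightedGraph X) (μ : Weight X) (V : X → ℝ) (f : Ell2 μ) : EReal :=
  if f ∈ finSupp μ then (energy G μ V (fun x => f x) : EReal) else ⊤

/-- The form `Q⁰` with Dirichlet boundary conditions at infinity, the closure of `Qc`. -/
noncomputable def Q0 (G : WeightedGraph X) (μ : Weight X) (V : X → ℝ) : Ell2 μ → EReal :=
  formClosure (Qc G μ V)

open Classical in
/-- The form `Q⁽ᴺ⁾` with Neumann boundary conditions at infinity: the Schrödinger form restricted
to the square summable functions of finite energy. -/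
noncomputable def QN (G : WeightedGraph X) (μ : Weight X) (V : X → ℝ) (f : Ell2 μ) : EReal :=
  if (fun x => f x) ∈ finiteEnergy G μ V then (energy G μ V (fun x => f x) : EReal) else ⊤

end DiscreteSchrodinger

/-! Every Markovian realization has a form `q` lying between `Q0` and `QN`: it extends the first,
and its domain is contained in that of the second. When `V ≥ 0` both extremes are themselves forms
of Markovian realizations, so uniqueness amounts to `Q0 = QN`.

For `V ≥ 0` the form `QN` is a sum of squares of continuous functionals (`QN_eq_sumForm`), hence
closed, and contractions shrink it term by term. Its polarization against a point mass is the formal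
operator (`polarForm_delta`). So a closed restriction of `QN` whose domain contains the finitely
supported functions yields a realization (`isRealization_operator`). Since a form is determined by
its operator (`IsFormOf.unique`), a unique Markovian realization forces `Q0 = QN`.

Conversely, let `q` be the form of a Markovian realization. The formula for `q(f, delta x)`, known
on the operator domain, extends to the whole form domain (`polarForm_delta_eq`). Cutting off at
height `1` then gives `V ≥ 0` (`potential_nonneg`). The main estimate is `energy_le`: the energy of
`f` over a finite set `K` is at most `q f`. Off `K`, the remainder `r = f - f 1_K` must pay at least
`∑ b x y * r y ^ 2` over `x ∈ K` for its jumps into `K`; this bound (`sum_sq_le`) comes from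
comparing truncations of `r` at consecutive heights. Hence the domain of `q` lies in that of `QN`.
If `QN = Q0`, density of finitely supported functions in the form norm gives `q = Q0`
(`eq_Q0_of_Q0_eq_QN`). -/

namespace DiscreteSchrodinger

/-! ### The Jordan-von Neumann theorem for nonnegative quadratic forms -/

section JordanVonNeumann

variable {D : Type*} [AddCommGroup D] [Module ℝ D]

/-- A nonnegative real-valued quadratic form, given by homogeneity and the parallelogram
identity. -/
structure IsNonnegQuadratic (p : D → ℝ) : Prop where
  smul : ∀ (c : ℝ) f, p (c • f) = c ^ 2 * p f
  parallelogram : ∀ f g, p (f + g) + p (f - g) = 2 * p f + 2 * p g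
  nonneg : ∀ f, 0 ≤ p f

/-- The polarization of a real-valued function. -/
noncomputable def polarization (p : D → ℝ) (f g : D) : ℝ := (p (f + g) - p (f - g)) / 4

namespace IsNonnegQuadratic

variable {p : D → ℝ} (hp : IsNonnegQuadratic p)
include hp

theorem map_neg (f : D) : p (-f) = p f := by simpa using hp.smul (-1) f

/-- The parallelogram identity for `f ± h` with `g` and for `g ± h` with `f`, combined with
alternating signs: the terms in which `f` and `g` have opposite signs cancel because `p` is even. -/
theorem polarization_add_left (f g h : D) :
    polarization p (f + g) h = polarization p f h + polarization p g h := by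
  have h1 := hp.parallelogram (f + h) g
  have h2 := hp.parallelogram (f - h) g
  have h3 := hp.parallelogram (g + h) f
  have h4 := hp.parallelogram (g - h) f
  have e1 : p (f + h - g) = p (g - h - f) := by rw [← hp.map_neg]; congr 1; abel
  have e2 : p (f - h - g) = p (g + h - f) := by rw [← hp.map_neg]; congr 1; abel
  have e3 : f + h + g = f + g + h := by abel
  have e4 : g + h + f = f + g + h := by abel
  have e5 : f - h + g = f + g - h := by abel
  have e6 : g - h + f = f + g - h := by abel
  rw [e3] at h1
  rw [e5] at h2
  rw [e4] at h3
  rw [e6] at h4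
  simp only [polarization]
  linarith

theorem two_mul_abs_polarization_le (f g : D) : 2 * |polarization p f g| ≤ p f + p g := by
  have h1 := hp.nonneg (f + g)
  have h2 := hp.nonneg (f - g)
  have h3 := hp.parallelogram f g
  simp only [polarization]
  rcases abs_cases ((p (f + g) - p (f - g)) / 4) with ⟨h, -⟩ | ⟨h, -⟩ <;> rw [h] <;> linarith

/-- Additivity in `c` is already known, so continuity at `0` suffices for real linearity. -/
theorem polarization_smul_left (c : ℝ) (f g : D) :
    polarization p (c • f) g = c * polarization p f g := by
  let φ : ℝ →+ ℝ :=
    { toFun := fun c => polarization p (c • f) g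
      map_zero' := by
        have h := hp.polarization_add_left 0 0 g
        rw [add_zero] at h
        rw [zero_smul]
        linarith
      map_add' := fun a b => by rw [add_smul, hp.polarization_add_left] }
  have hφ : ∀ a, φ a = polarization p (a • f) g := fun _ => rfl
  -- The bound for `n * a`, divided by `n`. The integer `n` is free: a large `n` makes `p g / n`
  -- small, after which `a` is taken small.
  have hbound : ∀ (a : ℝ) (n : ℕ), 0 < n → |φ a| ≤ n * a ^ 2 * p f + p g / n := by
    intro a n hn
    have hn' : (0 : ℝ) < n := by exact_mod_cast hn
    have h1 := hp.two_mul_abs_polarization_le (((n : ℝ) * a) • f) g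
    have h2 : φ (n * a) = n * φ a := by rw [← nsmul_eq_mul, _root_.map_nsmul, nsmul_eq_mul]
    rw [← hφ, h2, abs_mul, abs_of_pos hn', hp.smul] at h1
    have h3 : n * (n * a ^ 2 * p f + p g / n) = (n * a) ^ 2 * p f + p g := by
      field_simp
    refine le_of_mul_le_mul_left ?_ hn'
    rw [h3]
    have h4 : 0 ≤ n * |φ a| := by positivity
    linarith
  have hcont : Continuous φ := by
    refine continuous_of_continuousAt_zero φ ?_
    rw [Metric.continuousAt_iff]
    intro ε hε
    obtain ⟨n, hn⟩ := exists_nat_gt (2 * p g / ε)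
    have hg := hp.nonneg g
    have hf := hp.nonneg f
    have hn0 : (0 : ℝ) < n := lt_of_le_of_lt (by positivity) hn
    have hn1 : p g / n < ε / 2 := by
      rw [div_lt_iff₀ hε] at hn
      rw [div_lt_iff₀ hn0]
      linarith
    refine ⟨min 1 (ε / (2 * (n * (p f + 1)))), by positivity, fun {a} ha => ?_⟩
    rw [dist_zero_right, Real.norm_eq_abs, lt_min_iff] at ha
    have h1 := hbound a n (by exact_mod_cast hn0)
    rw [_root_.map_zero, dist_zero_right, Real.norm_eq_abs]
    have h2 : a ^ 2 ≤ |a| := by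
      rw [← sq_abs]
      nlinarith [abs_nonneg a]
    have h3 : |a| * (2 * (n * (p f + 1))) < ε := (lt_div_iff₀ (by positivity)).1 ha.2
    have h4 : n * a ^ 2 * p f ≤ n * |a| * (p f + 1) := by
      have : n * a ^ 2 ≤ n * |a| := by gcongr
      exact mul_le_mul this (by linarith) hf (by positivity)
    linarith
  have h := (φ.toRealLinearMap hcont).map_smul c 1
  simp only [AddMonoidHom.coe_toRealLinearMap, smul_eq_mul, mul_one] at h
  rw [hφ, hφ, one_smul] at h
  exact h

end IsNonnegQuadratic

end JordanVonNeumann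

/-! ### Semi-bounded quadratic forms on a Hilbert space -/

section Forms

variable {E : Type*} [NormedAddCommGroup E] [InnerProductSpace ℝ E] {q : E → EReal}

namespace IsQuadraticForm

variable (hq : IsQuadraticForm q)
include hq

theorem coe_toReal {f : E} (hf : f ∈ formDomain q) : ((q f).toReal : EReal) = q f :=
  EReal.coe_toReal hf (hq.ne_bot f)

theorem map_zero : q 0 = 0 := by simpa using hq.smul 0 0

theorem zero_mem : (0 : E) ∈ formDomain q := by
  simp [formDomain, hq.map_zero]

theorem smul_mem (c : ℝ) {f : E} (hf : f ∈ formDomain q) : c • f ∈ formDomain q := by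
  change q (c • f) ≠ ⊤
  rw [hq.smul, ← hq.coe_toReal hf, ← EReal.coe_mul]
  exact EReal.coe_ne_top _

theorem neg_mem {f : E} (hf : f ∈ formDomain q) : -f ∈ formDomain q := by
  simpa using hq.smul_mem (-1) hf

theorem add_mem {f g : E} (hf : f ∈ formDomain q) (hg : g ∈ formDomain q) :
    f + g ∈ formDomain q := by
  intro h
  have h1 := hq.parallelogram f g
  rw [h, EReal.top_add_of_ne_bot (hq.ne_bot _), ← hq.coe_toReal hf, ← hq.coe_toReal hg] at h1
  exact EReal.coe_ne_top (2 * (q f).toReal + 2 * (q g).toReal) (by rw [h1]; norm_cast)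

theorem sub_mem {f g : E} (hf : f ∈ formDomain q) (hg : g ∈ formDomain q) :
    f - g ∈ formDomain q := by
  rw [sub_eq_add_neg]
  exact hq.add_mem hf (hq.neg_mem hg)

/-- The domain of a quadratic form, as a subspace. -/
def domain : Submodule ℝ E where
  carrier := formDomain q
  zero_mem' := hq.zero_mem
  add_mem' := hq.add_mem
  smul_mem' c _ := hq.smul_mem c

theorem toReal_smul (c : ℝ) (f : E) : (q (c • f)).toReal = c ^ 2 * (q f).toReal := by
  rw [hq.smul, EReal.toReal_mul, EReal.toReal_coe]

theorem toReal_parallelogram {f g : E} (hf : f ∈ formDomain q) (hg : g ∈ formDomain q) :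
    (q (f + g)).toReal + (q (f - g)).toReal = 2 * (q f).toReal + 2 * (q g).toReal := by
  have h := hq.parallelogram f g
  rw [← hq.coe_toReal hf, ← hq.coe_toReal hg, ← hq.coe_toReal (hq.add_mem hf hg),
    ← hq.coe_toReal (hq.sub_mem hf hg), show (2 : EReal) = ((2 : ℝ) : EReal) from rfl] at h
  exact_mod_cast h

end IsQuadraticForm

/-- `q f + α * ‖f‖ ^ 2` as a real number. -/
noncomputable def shiftForm (q : E → EReal) (α : ℝ) (f : E) : ℝ := (q f).toReal + α * ‖f‖ ^ 2

/-- `q` is a closed form and `α` is so large that `‖f‖ ^ 2 ≤ q f + α * ‖f‖ ^ 2`. -/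
structure IsShift (q : E → EReal) (α : ℝ) : Prop where
  closed : IsClosedForm q
  norm_sq_le : ∀ f ∈ formDomain q, ‖f‖ ^ 2 ≤ shiftForm q α f

theorem IsClosedForm.exists_isShift (hq : IsClosedForm q) : ∃ α, 0 ≤ α ∧ IsShift q α := by
  obtain ⟨C, hC⟩ := hq.lowerSemibounded
  -- The summand `|C|` compensates the lower bound `C`; the summand `1` leaves a full `‖f‖ ^ 2`.
  refine ⟨1 + |C|, by positivity, hq, fun f hf => ?_⟩
  have h := hC f
  rw [← hq.isQuadraticForm.coe_toReal hf, EReal.coe_le_coe_iff] at h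
  have h1 : 0 ≤ (|C| + C) * ‖f‖ ^ 2 :=
    mul_nonneg (by linarith [neg_abs_le C]) (sq_nonneg _)
  simp only [shiftForm]
  linarith

theorem IsClosedForm.isShift_of_nonneg (hq : IsClosedForm q) (h0 : ∀ f, 0 ≤ q f) {α : ℝ}
    (hα : 1 ≤ α) : IsShift q α := by
  refine ⟨hq, fun f hf => ?_⟩
  have h := EReal.toReal_nonneg (h0 f)
  have h1 : 0 ≤ (α - 1) * ‖f‖ ^ 2 := mul_nonneg (by linarith) (sq_nonneg _)
  simp only [shiftForm]
  linarith

namespace IsShift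

variable {α : ℝ} (hq : IsShift q α)
include hq

theorem isNonnegQuadratic :
    IsNonnegQuadratic (fun f : hq.closed.isQuadraticForm.domain => shiftForm q α (f : E)) where
  smul c f := by
    simp only [shiftForm, Submodule.coe_smul, hq.closed.isQuadraticForm.toReal_smul, norm_smul,
      Real.norm_eq_abs, mul_pow, sq_abs]
    ring
  parallelogram f g := by
    have h1 := hq.closed.isQuadraticForm.toReal_parallelogram f.2 g.2
    have h2 := parallelogram_law_with_norm ℝ (f : E) g
    simp only [shiftForm, Submodule.coe_add, Submodule.coe_sub]
    linear_combination h1 + α * h2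
  nonneg f := (sq_nonneg _).trans (hq.norm_sq_le f f.2)

theorem polarForm_eq (f g : hq.closed.isQuadraticForm.domain) :
    polarForm q f g = polarization (fun f : hq.closed.isQuadraticForm.domain =>
      shiftForm q α (f : E)) f g - α * inner ℝ (f : E) g := by
  have h1 := norm_add_sq_real (f : E) g
  have h2 := norm_sub_sq_real (f : E) g
  simp only [polarForm, polarization, shiftForm, Submodule.coe_add, Submodule.coe_sub]
  rw [h1, h2]
  ring

end IsShift

namespace IsClosedForm

variable (hq : IsClosedForm q) {f g h : E}
include hq

theorem polarForm_add_left (hf : f ∈ formDomain q) (hg : g ∈ formDomain q)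
    (hh : h ∈ formDomain q) : polarForm q (f + g) h = polarForm q f h + polarForm q g h := by
  obtain ⟨α, -, hα⟩ := hq.exists_isShift
  have h1 := hα.isNonnegQuadratic.polarization_add_left ⟨f, hf⟩ ⟨g, hg⟩ ⟨h, hh⟩
  have e1 := hα.polarForm_eq ⟨f, hf⟩ ⟨h, hh⟩
  have e2 := hα.polarForm_eq ⟨g, hg⟩ ⟨h, hh⟩
  have e3 := hα.polarForm_eq (⟨f, hf⟩ + ⟨g, hg⟩) ⟨h, hh⟩
  simp only [Submodule.coe_add] at e1 e2 e3
  rw [e1, e2, e3, h1, inner_add_left]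
  ring

theorem polarForm_smul_left (c : ℝ) (hf : f ∈ formDomain q) (hg : g ∈ formDomain q) :
    polarForm q (c • f) g = c * polarForm q f g := by
  obtain ⟨α, -, hα⟩ := hq.exists_isShift
  have h1 := hα.isNonnegQuadratic.polarization_smul_left c ⟨f, hf⟩ ⟨g, hg⟩
  have e1 := hα.polarForm_eq ⟨f, hf⟩ ⟨g, hg⟩
  have e3 := hα.polarForm_eq (c • ⟨f, hf⟩) ⟨g, hg⟩
  simp only [Submodule.coe_smul] at e1 e3
  rw [e1, e3, h1, real_inner_smul_left]
  ring

theorem polarForm_comm (f g : E) : polarForm q f g = polarForm q g f := by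
  have h := hq.isQuadraticForm.toReal_smul (-1) (f - g)
  simp only [neg_smul, one_smul, neg_sub, even_two, Even.neg_pow, one_pow, one_mul] at h
  rw [polarForm, polarForm, add_comm, h]

theorem polarForm_self (f : E) : polarForm q f f = (q f).toReal := by
  have h := hq.isQuadraticForm.toReal_smul 2 f
  rw [two_smul] at h
  rw [polarForm, h, sub_self, hq.isQuadraticForm.map_zero]
  simp only [EReal.toReal_zero]
  ring

theorem polarForm_add_right (hf : f ∈ formDomain q) (hg : g ∈ formDomain q)
    (hh : h ∈ formDomain q) : polarForm q f (g + h) = polarForm q f g + polarForm q f h := by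
  rw [hq.polarForm_comm, hq.polarForm_add_left hg hh hf, hq.polarForm_comm g,
    hq.polarForm_comm h]

theorem polarForm_smul_right (c : ℝ) (hf : f ∈ formDomain q) (hg : g ∈ formDomain q) :
    polarForm q f (c • g) = c * polarForm q f g := by
  rw [hq.polarForm_comm, hq.polarForm_smul_left c hg hf, hq.polarForm_comm]

theorem polarForm_sub_left (hf : f ∈ formDomain q) (hg : g ∈ formDomain q)
    (hh : h ∈ formDomain q) : polarForm q (f - g) h = polarForm q f h - polarForm q g h := by
  have h1 := hq.polarForm_add_left (hq.isQuadraticForm.sub_mem hf hg) hg hh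
  rw [sub_add_cancel] at h1
  linarith

theorem polarForm_zero_left (hf : f ∈ formDomain q) : polarForm q 0 f = 0 := by
  simpa using hq.polarForm_smul_left 0 hf hf

theorem polarForm_sum_left {ι : Type*} (s : Finset ι) (c : ι → ℝ) (u : ι → E)
    (hu : ∀ i, u i ∈ formDomain q) (hg : g ∈ formDomain q) :
    polarForm q (∑ i ∈ s, c i • u i) g = ∑ i ∈ s, c i * polarForm q (u i) g := by
  classical
  induction s using Finset.induction_on with
  | empty => simpa using hq.polarForm_zero_left hg
  | insert i s hi ih =>
    have hmem : ∑ i ∈ s, c i • u i ∈ hq.isQuadraticForm.domain :=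
      Submodule.sum_mem _ (fun i _ => Submodule.smul_mem _ _ (hu i))
    rw [Finset.sum_insert hi, Finset.sum_insert hi, hq.polarForm_add_left
      (hq.isQuadraticForm.smul_mem _ (hu i)) hmem hg, ih, hq.polarForm_smul_left _ (hu i) hg]

theorem toReal_add (hf : f ∈ formDomain q) (hg : g ∈ formDomain q) :
    (q (f + g)).toReal = (q f).toReal + 2 * polarForm q f g + (q g).toReal := by
  have h := hq.isQuadraticForm.toReal_parallelogram hf hg
  rw [polarForm]
  linarith

theorem polarForm_sq_le (h0 : ∀ f, 0 ≤ q f) (hf : f ∈ formDomain q) (hg : g ∈ formDomain q) :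
    polarForm q f g ^ 2 ≤ (q f).toReal * (q g).toReal := by
  have key : ∀ t : ℝ, 0 ≤ (q g).toReal * (t * t) + 2 * polarForm q f g * t + (q f).toReal := by
    intro t
    have h1 := hq.toReal_add hf (hq.isQuadraticForm.smul_mem t hg)
    rw [hq.polarForm_smul_right t hf hg, hq.isQuadraticForm.toReal_smul] at h1
    have h2 := EReal.toReal_nonneg (h0 (f + t • g))
    rw [h1] at h2
    linarith
  have h := discrim_le_zero key
  rw [discrim] at h
  linarith

end IsClosedForm

end Forms

/-! ### The form domain as a Hilbert space -/

section FormSpace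

variable {E : Type*} [NormedAddCommGroup E] [InnerProductSpace ℝ E] {q : E → EReal} {α : ℝ}

/-- The domain of a closed form `q`, with the inner product `q(f, g) + α * ⟪f, g⟫`. -/
def FormSpace (hq : IsShift q α) : Type _ := ↥(hq.closed.isQuadraticForm.domain)

namespace FormSpace

variable {hq : IsShift q α}

instance : AddCommGroup (FormSpace hq) :=
  inferInstanceAs (AddCommGroup ↥(hq.closed.isQuadraticForm.domain))

instance : Module ℝ (FormSpace hq) :=
  inferInstanceAs (Module ℝ ↥(hq.closed.isQuadraticForm.domain))

/-- The embedding of the form domain. -/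
def incl : FormSpace hq →ₗ[ℝ] E := (hq.closed.isQuadraticForm.domain).subtype

/-- An element of the form domain as an element of the form space. -/
def mk (f : E) (hf : f ∈ formDomain q) : FormSpace hq := ⟨f, hf⟩

theorem incl_mk (f : E) (hf : f ∈ formDomain q) : incl (mk f hf : FormSpace hq) = f := rfl

theorem incl_mem (u : FormSpace hq) : incl u ∈ formDomain q := u.2

theorem incl_injective : Function.Injective (incl : FormSpace hq → E) := Subtype.val_injective

noncomputable instance core : InnerProductSpace.Core ℝ (FormSpace hq) where
  inner f g := polarForm q (incl f) (incl g) + α * inner ℝ (incl f) (incl g)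
  conj_inner_symm f g := by
    simp only [conj_trivial]
    rw [hq.closed.polarForm_comm, real_inner_comm]
  re_inner_nonneg f := by
    simp only [RCLike.re_to_real]
    rw [hq.closed.polarForm_self, real_inner_self_eq_norm_sq]
    exact (sq_nonneg _).trans (hq.norm_sq_le _ f.2)
  add_left f g h := by
    rw [map_add, hq.closed.polarForm_add_left (incl_mem f) (incl_mem g) (incl_mem h), inner_add_left]
    ring
  smul_left f g c := by
    simp only [conj_trivial]
    rw [map_smul, hq.closed.polarForm_smul_left c (incl_mem f) (incl_mem g), real_inner_smul_left]
    ring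
  definite f hf := by
    rw [hq.closed.polarForm_self, real_inner_self_eq_norm_sq] at hf
    have h := hq.norm_sq_le _ f.2
    rw [shiftForm] at h
    have h1 : ‖incl f‖ ^ 2 ≤ 0 := h.trans hf.le
    have h2 : incl f = 0 := by
      rw [← norm_eq_zero]
      exact pow_eq_zero_iff two_ne_zero |>.1 (le_antisymm h1 (sq_nonneg _))
    exact incl_injective (by rw [h2, map_zero])

noncomputable instance : NormedAddCommGroup (FormSpace hq) :=
  InnerProductSpace.Core.toNormedAddCommGroup (𝕜 := ℝ)

noncomputable instance : InnerProductSpace ℝ (FormSpace hq) :=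
  InnerProductSpace.ofCore (core (hq := hq)).toCore

theorem inner_def (f g : FormSpace hq) :
    inner ℝ f g = polarForm q (incl f) (incl g) + α * inner ℝ (incl f) (incl g) := rfl

theorem norm_sq_def (f : FormSpace hq) : ‖f‖ ^ 2 = (q (incl f)).toReal + α * ‖incl f‖ ^ 2 := by
  rw [← real_inner_self_eq_norm_sq, inner_def, hq.closed.polarForm_self,
    real_inner_self_eq_norm_sq]

theorem norm_incl_le (f : FormSpace hq) : ‖incl f‖ ≤ ‖f‖ := by
  refine le_of_sq_le_sq ?_ (norm_nonneg _)
  rw [norm_sq_def]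
  exact hq.norm_sq_le _ f.2

/-- The embedding of the form domain as a continuous map. -/
noncomputable def inclL : FormSpace hq →L[ℝ] E :=
  LinearMap.mkContinuous incl 1 (fun f => by simpa using norm_incl_le f)

theorem inclL_apply (f : FormSpace hq) : inclL f = incl f := rfl

theorem toReal_eq (f : FormSpace hq) : (q (incl f)).toReal = ‖f‖ ^ 2 - α * ‖inclL f‖ ^ 2 := by
  rw [norm_sq_def, inclL_apply]
  ring

/-- Together with `isFormCauchy_iff`, this translates the sequential notion of closedness into norm
convergence; the term `α * ‖·‖ ^ 2` is harmless because it converges along with the sequence in `E`.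
-/
theorem tendsto_iff {u : ℕ → FormSpace hq} {f : FormSpace hq} :
    Tendsto u atTop (𝓝 f) ↔ Tendsto (fun n => incl (u n)) atTop (𝓝 (incl f)) ∧
      Tendsto (fun n => q (incl (u n) - incl f)) atTop (𝓝 0) := by
  have hcoe : ∀ n, q (incl (u n) - incl f)
      = ((‖u n - f‖ ^ 2 - α * ‖inclL (u n - f)‖ ^ 2 : ℝ) : EReal) := by
    intro n
    rw [← toReal_eq, map_sub]
    exact (hq.closed.isQuadraticForm.coe_toReal (incl_mem (u n - f))).symm
  constructor
  · intro h
    refine ⟨(inclL.continuous.tendsto f).comp h, ?_⟩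
    simp only [hcoe]
    have h1 : Tendsto (fun n => u n - f) atTop (𝓝 0) := by
      simpa using h.sub_const f
    have h2 : Continuous (fun v : FormSpace hq =>
      ((‖v‖ ^ 2 - α * ‖inclL v‖ ^ 2 : ℝ) : EReal)) :=
      continuous_coe_real_ereal.comp (by fun_prop)
    simpa [Function.comp_def] using (h2.tendsto 0).comp h1
  · rintro ⟨h1, h2⟩
    simp only [hcoe] at h2
    rw [← EReal.coe_zero, EReal.tendsto_coe] at h2
    have h3 : Tendsto (fun n => α * ‖inclL (u n - f)‖ ^ 2) atTop (𝓝 0) := by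
      have : Tendsto (fun n => α * ‖incl (u n) - incl f‖ ^ 2) atTop (𝓝 (α * ‖incl f - incl f‖ ^ 2)) :=
        ((h1.sub_const _).norm.pow 2).const_mul α
      simpa [inclL_apply] using this
    have h4 := h2.add h3
    simp only [sub_add_cancel, add_zero] at h4
    rw [tendsto_iff_norm_sub_tendsto_zero]
    have h5 := h4.sqrt
    simpa [Real.sqrt_sq] using h5

theorem isFormCauchy_iff {u : ℕ → FormSpace hq} :
    IsFormCauchy q (fun n => incl (u n)) ↔ CauchySeq u := by
  have hcoe : ∀ p : ℕ × ℕ, q (incl (u p.1) - incl (u p.2))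
      = ((‖u p.1 - u p.2‖ ^ 2 - α * ‖incl (u p.1) - incl (u p.2)‖ ^ 2 : ℝ) : EReal) := by
    intro n
    rw [← map_sub, ← inclL_apply, ← toReal_eq]
    exact (hq.closed.isQuadraticForm.coe_toReal (incl_mem (u n.1 - u n.2))).symm
  have hnorm : ∀ {F : Type _} [NormedAddCommGroup F] (v : ℕ → F), CauchySeq v ↔
      Tendsto (fun p : ℕ × ℕ => ‖v p.1 - v p.2‖ ^ 2) atTop (𝓝 0) := by
    intro F _ v
    rw [cauchySeq_iff_tendsto_dist_atTop_0]
    simp only [dist_eq_norm]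
    constructor
    · intro h
      simpa using h.pow 2
    · intro h
      simpa [Real.sqrt_sq] using h.sqrt
  constructor
  · rintro ⟨-, h1, h2⟩
    simp only [hcoe] at h2
    rw [← EReal.coe_zero, EReal.tendsto_coe] at h2
    have h3 := h2.add (((hnorm _).1 h1).const_mul α)
    simp only [sub_add_cancel, mul_zero, add_zero] at h3
    exact (hnorm _).2 h3
  · intro h
    have h1 : CauchySeq (fun n => incl (u n)) := h.map inclL.uniformContinuous
    refine ⟨fun n => incl_mem _, h1, ?_⟩
    simp only [hcoe]
    rw [← EReal.coe_zero, EReal.tendsto_coe]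
    simpa using ((hnorm _).1 h).sub (((hnorm _).1 h1).const_mul α)

instance : CompleteSpace (FormSpace hq) := by
  refine Metric.complete_of_cauchySeq_tendsto (fun u hu => ?_)
  obtain ⟨f, hf, h1, h2⟩ := hq.closed.complete _ (isFormCauchy_iff.2 hu)
  exact ⟨mk f hf, tendsto_iff.2 ⟨h1, h2⟩⟩

theorem tendsto_toReal {u : ℕ → FormSpace hq} {f : FormSpace hq} (h : Tendsto u atTop (𝓝 f)) :
    Tendsto (fun n => (q (incl (u n))).toReal) atTop (𝓝 (q (incl f)).toReal) := by
  simp only [toReal_eq]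
  have h2 : Continuous (fun v : FormSpace hq => ‖v‖ ^ 2 - α * ‖inclL v‖ ^ 2) := by fun_prop
  exact (h2.tendsto f).comp h

theorem tendsto_form {u : ℕ → FormSpace hq} {f : FormSpace hq} (h : Tendsto u atTop (𝓝 f)) :
    Tendsto (fun n => q (incl (u n))) atTop (𝓝 (q (incl f))) := by
  have h1 := EReal.tendsto_coe.2 (tendsto_toReal h)
  rw [hq.closed.isQuadraticForm.coe_toReal (incl_mem f)] at h1
  exact h1.congr (fun n => hq.closed.isQuadraticForm.coe_toReal (incl_mem _))

variable [CompleteSpace E]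

/-- In terms of the operator `H` of `q`, the left inner product is `q(u, v) + α * ⟪u, v⟫` for `u =
inclL.adjoint g`, so the adjoint of the embedding is the resolvent `(H + α)⁻¹`. -/
theorem inner_adjoint_left (g : E) (v : FormSpace hq) :
    inner ℝ ((inclL (hq := hq)).adjoint g) v = inner ℝ g (incl v) :=
  ContinuousLinearMap.adjoint_inner_left _ _ _

/-- The orthogonal complement of the range is the kernel of the embedding, which is trivial. As the
range is the operator domain, this makes the operator domain a form core. -/
theorem denseRange_adjoint : DenseRange (inclL (hq := hq)).adjoint := by
  have h : ((inclL (hq := hq)).adjoint.range).topologicalClosure = ⊤ := by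
    rw [Submodule.topologicalClosure_eq_top_iff, Submodule.eq_bot_iff]
    intro v hv
    have h1 : inner ℝ (incl v) (incl v) = (0 : ℝ) := by
      rw [← inner_adjoint_left]
      exact (Submodule.mem_orthogonal _ _).1 hv _ ⟨incl v, rfl⟩
    exact incl_injective (by rw [inner_self_eq_zero.1 h1, map_zero])
  exact Submodule.dense_iff_topologicalClosure_eq_top.2 h

/-- Weak convergence in the form space: against vectors `inclL.adjoint g` it is convergence in `E`,
and boundedness extends it from this dense set to every `w`. -/
theorem tendsto_inner_of_bounded {v : ℕ → FormSpace hq} {f : FormSpace hq} {C : ℝ}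
    (hC : ∀ n, ‖v n‖ ≤ C) (hv : Tendsto (fun n => incl (v n)) atTop (𝓝 (incl f)))
    (w : FormSpace hq) : Tendsto (fun n => inner ℝ w (v n)) atTop (𝓝 (inner ℝ w f)) := by
  rw [Metric.tendsto_atTop]
  intro ε hε
  have hC0 : 0 ≤ C := (norm_nonneg _).trans (hC 0)
  obtain ⟨w', ⟨g, rfl⟩, hg⟩ := Metric.mem_closure_iff.1 (denseRange_adjoint w)
    (ε / (2 * (C + ‖f‖ + 1))) (by positivity)
  have h1 : Tendsto (fun n => inner ℝ ((inclL (hq := hq)).adjoint g) (v n)) atTop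
      (𝓝 (inner ℝ ((inclL (hq := hq)).adjoint g) f)) := by
    simp only [inner_adjoint_left]
    exact tendsto_const_nhds.inner hv
  obtain ⟨N, hN⟩ := Metric.tendsto_atTop.1 h1 (ε / 2) (by positivity)
  refine ⟨N, fun n hn => ?_⟩
  have h2 := hN n hn
  rw [Real.dist_eq, ← inner_sub_right] at h2 ⊢
  set w' := (inclL (hq := hq)).adjoint g
  have h3 : inner ℝ w (v n - f) = inner ℝ (w - w') (v n - f) + inner ℝ w' (v n - f) := by
    rw [← inner_add_left, sub_add_cancel]
  have h4 : |inner ℝ (w - w') (v n - f)| ≤ ε / 2 := by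
    have h5 := abs_real_inner_le_norm (w - w') (v n - f)
    have h6 : ‖v n - f‖ ≤ C + ‖f‖ + 1 := (norm_sub_le _ _).trans (by linarith [hC n])
    rw [dist_eq_norm] at hg
    calc _ ≤ ‖w - w'‖ * ‖v n - f‖ := h5
      _ ≤ ε / (2 * (C + ‖f‖ + 1)) * (C + ‖f‖ + 1) := by gcongr
      _ = ε / 2 := by field_simp
  rw [h3]
  linarith [abs_add_le (inner ℝ (w - w') (v n - f)) (inner ℝ w' (v n - f))]

/-- A norm-closed subspace is weakly closed, being its own double orthogonal complement. -/
theorem mem_closure_of_bounded {S : Submodule ℝ (FormSpace hq)} {v : ℕ → FormSpace hq}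
    {f : FormSpace hq} {C : ℝ} (hS : ∀ n, v n ∈ S) (hC : ∀ n, ‖v n‖ ≤ C)
    (hv : Tendsto (fun n => incl (v n)) atTop (𝓝 (incl f))) : f ∈ S.topologicalClosure := by
  rw [← Submodule.orthogonal_orthogonal_eq_closure, Submodule.mem_orthogonal]
  intro w hw
  have h1 := tendsto_inner_of_bounded hC hv w
  have h2 : ∀ n, inner ℝ w (v n) = (0 : ℝ) := fun n =>
    Submodule.inner_left_of_mem_orthogonal (hS n) hw
  simp only [h2] at h1
  exact (tendsto_nhds_unique h1 tendsto_const_nhds)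

end FormSpace

variable [CompleteSpace E]

/-- The resolvent equation of a closed form is solvable. -/
theorem IsShift.exists_resolvent (hq : IsShift q α) (g : E) :
    ∃ u ∈ formDomain q, ∀ h ∈ formDomain q, polarForm q u h + α * inner ℝ u h = inner ℝ g h :=
  ⟨FormSpace.incl ((FormSpace.inclL (hq := hq)).adjoint g), FormSpace.incl_mem _, fun h hh =>
    FormSpace.inner_adjoint_left g (FormSpace.mk h hh)⟩

end FormSpace

/-! ### Closed forms and their self-adjoint operators -/

section Operators

variable {E : Type*} [NormedAddCommGroup E] [InnerProductSpace ℝ E] {q q' : E → EReal}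

namespace IsClosedForm

/-- Convergence in the form norm implies convergence of the values of the form. -/
theorem isFormCauchy_of_tendsto (hq : IsClosedForm q) {u : ℕ → E} {f : E}
    (hu : ∀ n, u n ∈ formDomain q) (hf : f ∈ formDomain q) (h1 : Tendsto u atTop (𝓝 f))
    (h2 : Tendsto (fun n => q (u n - f)) atTop (𝓝 0)) :
    IsFormCauchy q u ∧ Tendsto (fun n => q (u n)) atTop (𝓝 (q f)) := by
  obtain ⟨α, -, hα⟩ := hq.exists_isShift
  have h := (FormSpace.tendsto_iff (hq := hα) (u := fun n => FormSpace.mk (u n) (hu n))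
    (f := FormSpace.mk f hf)).2 ⟨h1, h2⟩
  exact ⟨FormSpace.isFormCauchy_iff.2 h.cauchySeq, FormSpace.tendsto_form h⟩

/-- Two closed forms that agree on a subspace agree on its closure in the form norm. -/
theorem eq_of_tendsto (hq : IsClosedForm q) (hq' : IsClosedForm q') {S : Submodule ℝ E}
    (hS : ∀ f ∈ S, f ∈ formDomain q ∧ f ∈ formDomain q' ∧ q f = q' f) {u : ℕ → E} {f : E}
    (hu : ∀ n, u n ∈ S) (hf : f ∈ formDomain q) (h1 : Tendsto u atTop (𝓝 f))
    (h2 : Tendsto (fun n => q (u n - f)) atTop (𝓝 0)) : f ∈ formDomain q' ∧ q' f = q f := by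
  obtain ⟨h3, h4⟩ := hq.isFormCauchy_of_tendsto (fun n => (hS _ (hu n)).1) hf h1 h2
  have h5 : IsFormCauchy q' u := by
    refine ⟨fun n => (hS _ (hu n)).2.1, h3.2.1, h3.2.2.congr (fun p => ?_)⟩
    exact (hS _ (S.sub_mem (hu _) (hu _))).2.2
  obtain ⟨f', hf', h6, h7⟩ := hq'.complete u h5
  obtain rfl := tendsto_nhds_unique h1 h6
  have h8 := (hq'.isFormCauchy_of_tendsto (fun n => (hS _ (hu n)).2.1) hf' h6 h7).2
  exact ⟨hf', tendsto_nhds_unique (h8.congr (fun n => (hS _ (hu n)).2.2.symm)) h4⟩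

/-- The graph of the operator associated with a closed form. -/
def operatorGraph (hq : IsClosedForm q) : Submodule ℝ (E × E) where
  carrier := {p | p.1 ∈ formDomain q ∧ ∀ h ∈ formDomain q, polarForm q p.1 h = inner ℝ p.2 h}
  zero_mem' := ⟨hq.isQuadraticForm.zero_mem, fun h hh => by
    simp [hq.polarForm_zero_left hh]⟩
  add_mem' := fun {a b} ha hb => ⟨hq.isQuadraticForm.add_mem ha.1 hb.1, fun h hh => by
    rw [Prod.fst_add, hq.polarForm_add_left ha.1 hb.1 hh, ha.2 h hh, hb.2 h hh, Prod.snd_add,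
      inner_add_left]⟩
  smul_mem' := fun c a ha => ⟨hq.isQuadraticForm.smul_mem c ha.1, fun h hh => by
    rw [Prod.smul_fst, hq.polarForm_smul_left c ha.1 hh, ha.2 h hh, Prod.smul_snd,
      real_inner_smul_left]⟩

theorem mem_operatorGraph (hq : IsClosedForm q) {f g : E} : (f, g) ∈ hq.operatorGraph ↔
    f ∈ formDomain q ∧ ∀ h ∈ formDomain q, polarForm q f h = inner ℝ g h := Iff.rfl

/-- The operator associated with a closed form. -/
noncomputable def operator (hq : IsClosedForm q) : E →ₗ.[ℝ] E := hq.operatorGraph.toLinearPMap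

/-- The relation is single-valued: if `f = 0`, then `g` is orthogonal to the dense form domain. -/
theorem operator_graph (hq : IsClosedForm q) : hq.operator.graph = hq.operatorGraph := by
  refine Submodule.toLinearPMap_graph_eq _ ?_
  rintro ⟨f, g⟩ ⟨-, h2⟩ rfl
  refine hq.dense.eq_zero_of_inner_left ℝ (fun h hh => ?_)
  rw [← h2 h hh, hq.polarForm_zero_left hh]

theorem isFormOf_operator (hq : IsClosedForm q) : IsFormOf q hq.operator :=
  ⟨hq, fun f g => by rw [operator_graph, mem_operatorGraph]⟩

variable [CompleteSpace E]

theorem exists_resolvent_mem (hq : IsClosedForm q) {α : ℝ} (hα : IsShift q α) (g : E) :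
    ∃ u, (u, g - α • u) ∈ hq.operatorGraph := by
  obtain ⟨u, hu, h⟩ := hα.exists_resolvent g
  refine ⟨u, hu, fun v hv => ?_⟩
  rw [inner_sub_left, real_inner_smul_left, ← h v hv]
  ring

/-- If `g` is orthogonal to the operator domain, then it is orthogonal to `u = (H + α)⁻¹ g`. This
makes the form norm of `u` vanish, so `u = 0` and hence `g = 0`. -/
theorem operator_dense (hq : IsClosedForm q) : Dense (hq.operator.domain : Set E) := by
  rw [Submodule.dense_iff_topologicalClosure_eq_top, Submodule.topologicalClosure_eq_top_iff,
    Submodule.eq_bot_iff]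
  intro g hg
  obtain ⟨α, -, hα⟩ := hq.exists_isShift
  obtain ⟨u, hu⟩ := hq.exists_resolvent_mem hα g
  have h1 : u ∈ hq.operator.domain := by
    rw [LinearPMap.mem_domain_iff]
    exact ⟨_, by rw [operator_graph]; exact hu⟩
  have h2 : inner ℝ u g = (0 : ℝ) := (Submodule.mem_orthogonal _ _).1 hg u h1
  have h3 := hu.2 u hu.1
  simp only at h3
  rw [hq.polarForm_self, inner_sub_left, real_inner_comm, h2, real_inner_smul_left,
    real_inner_self_eq_norm_sq] at h3
  have h4 := hα.norm_sq_le u hu.1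
  rw [shiftForm, h3] at h4
  have h5 : u = 0 := by
    have : ‖u‖ ^ 2 = 0 := le_antisymm (by linarith) (sq_nonneg _)
    exact norm_eq_zero.1 (pow_eq_zero_iff two_ne_zero |>.1 this)
  refine hq.dense.eq_zero_of_inner_left ℝ (fun h hh => ?_)
  have h6 := hu.2 h hh
  simp only [h5, smul_zero, sub_zero] at h6
  rw [← h6, hq.polarForm_zero_left hh]

/-- A symmetric operator for which `H + α` is onto is self-adjoint. For `(v, w)` in the adjoint
graph, take `v'` in the domain with `(H + α) v' = w + α v`; then `v - v'` is orthogonal to the range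
of `H + α`, hence zero. -/
theorem operator_isSelfAdjoint (hq : IsClosedForm q) : IsSelfAdjoint hq.operator := by
  rw [LinearPMap.isSelfAdjoint_def]
  apply LinearPMap.eq_of_eq_graph
  rw [LinearPMap.adjoint_graph_eq_graph_adjoint hq.operator_dense, operator_graph]
  have hsymm : ∀ {a b v w : E}, (a, b) ∈ hq.operatorGraph → (v, w) ∈ hq.operatorGraph →
      inner ℝ b v = (inner ℝ a w : ℝ) := by
    intro a b v w h1 h2
    rw [← h1.2 v h2.1, hq.polarForm_comm, real_inner_comm, ← h2.2 a h1.1]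
  ext ⟨v, w⟩
  rw [Submodule.mem_adjoint_iff]
  constructor
  · intro h
    obtain ⟨α, -, hα⟩ := hq.exists_isShift
    obtain ⟨v', hv'⟩ := hq.exists_resolvent_mem hα (w + α • v)
    have key : v - v' = 0 := by
      rw [← inner_self_eq_zero (𝕜 := ℝ)]
      obtain ⟨u, hu⟩ := hq.exists_resolvent_mem hα (v - v')
      have h1 := h _ _ hu
      have h2 := hsymm hu hv'
      simp only [inner_sub_left, inner_sub_right, inner_add_right, real_inner_smul_left,
        real_inner_smul_right] at h1 h2 ⊢
      linarith
    obtain rfl := sub_eq_zero.1 key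
    simpa using hv'
  · intro h a b hab
    rw [hsymm hab h, sub_self]

end IsClosedForm

variable {H : E →ₗ.[ℝ] E}

theorem IsFormOf.mem_of_mem_domain (hq : IsFormOf q H) {f : E} (hf : f ∈ H.domain) :
    f ∈ formDomain q :=
  ((hq.mem_graph_iff f _).1 (H.mem_graph ⟨f, hf⟩)).1

theorem IsFormOf.polarForm_eq (hq : IsFormOf q H) (f : H.domain) {h : E}
    (hh : h ∈ formDomain q) : polarForm q f h = inner ℝ (H f) h :=
  ((hq.mem_graph_iff f _).1 (H.mem_graph f)).2 h hh

theorem IsFormOf.operator_eq (hq : IsFormOf q H) : H = hq.closed.operator := by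
  apply LinearPMap.eq_of_eq_graph
  ext ⟨f, g⟩
  rw [hq.mem_graph_iff, hq.closed.operator_graph, hq.closed.mem_operatorGraph]

variable [CompleteSpace E]

/-- The domain of an operator is dense in the domain of its form. -/
theorem IsFormOf.exists_tendsto (hq : IsFormOf q H) {f : E} (hf : f ∈ formDomain q) :
    ∃ u : ℕ → E, (∀ n, u n ∈ H.domain) ∧ Tendsto u atTop (𝓝 f) ∧
      Tendsto (fun n => q (u n - f)) atTop (𝓝 0) := by
  obtain ⟨α, -, hα⟩ := hq.closed.exists_isShift
  obtain ⟨u, hu, hlim⟩ := mem_closure_iff_seq_limit.1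
    (FormSpace.denseRange_adjoint (hq := hα) (FormSpace.mk f hf))
  have h1 := FormSpace.tendsto_iff.1 hlim
  refine ⟨fun n => FormSpace.incl (u n), fun n => ?_, h1.1, h1.2⟩
  obtain ⟨g, hg⟩ := hu n
  change FormSpace.incl (u n) ∈ H.domain
  rw [← hg, LinearPMap.mem_domain_iff]
  set w := (FormSpace.inclL (hq := hα)).adjoint g with hw
  refine ⟨g - α • FormSpace.incl w, (hq.mem_graph_iff _ _).2
    ⟨FormSpace.incl_mem _, fun h hh => ?_⟩⟩
  have h2 := FormSpace.inner_adjoint_left g (FormSpace.mk h hh : FormSpace hα)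
  rw [← hw, FormSpace.inner_def, FormSpace.incl_mk] at h2
  rw [inner_sub_left, real_inner_smul_left, ← h2]
  ring

/-- The form of an operator is unique. -/
theorem IsFormOf.unique (hq : IsFormOf q H) (hq' : IsFormOf q' H) : q = q' := by
  have key : ∀ {p p' : E → EReal}, IsFormOf p H → IsFormOf p' H → ∀ f ∈ formDomain p,
      f ∈ formDomain p' ∧ p' f = p f := by
    intro p p' hp hp' f hf
    obtain ⟨u, hu, h1, h2⟩ := hp.exists_tendsto hf
    -- On the operator domain both forms equal `⟪H v, v⟫`, and this domain is dense for the form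
    -- norm.
    refine hp.closed.eq_of_tendsto hp'.closed (S := H.domain) (fun v hv => ?_) hu hf h1 h2
    have hv1 := hp.mem_of_mem_domain hv
    have hv2 := hp'.mem_of_mem_domain hv
    refine ⟨hv1, hv2, ?_⟩
    rw [← hp.closed.isQuadraticForm.coe_toReal hv1, ← hp'.closed.isQuadraticForm.coe_toReal hv2,
      ← hp.closed.polarForm_self, ← hp'.closed.polarForm_self, hp.polarForm_eq ⟨v, hv⟩ hv1,
      hp'.polarForm_eq ⟨v, hv⟩ hv2]
  ext f
  by_cases hf : f ∈ formDomain q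
  · exact (key hq hq' f hf).2.symm
  · have hf' : f ∉ formDomain q' := fun h => hf (key hq' hq f h).1
    simp only [formDomain, Set.mem_ofPred_eq, not_not] at hf hf'
    rw [hf, hf']

end Operators

/-! ### Closures of restrictions of closed forms -/

section Restriction

variable {E : Type*} [NormedAddCommGroup E] [InnerProductSpace ℝ E] {q p : E → EReal}

/-- `p` is the restriction of the form `q` to the subspace `S`. -/
structure IsFormRestriction (p q : E → EReal) (S : Submodule ℝ E) : Prop where
  le_domain : ∀ f ∈ S, f ∈ formDomain q
  eq_of_mem : ∀ f ∈ S, p f = q f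
  eq_top : ∀ f ∉ S, p f = ⊤

namespace IsFormRestriction

variable {S : Submodule ℝ E} (hp : IsFormRestriction p q S)
include hp

theorem mem_iff {f : E} : f ∈ formDomain p ↔ f ∈ S := by
  constructor
  · intro h
    by_contra hf
    exact h (hp.eq_top f hf)
  · intro h
    change p f ≠ ⊤
    rw [hp.eq_of_mem f h]
    exact hp.le_domain f h

/-- For the parallelogram identity: `f + g` and `f - g` both lie in `S` exactly when `f` and `g` do,
so outside this case both sides are `⊤`. -/
theorem isQuadraticForm (hq : IsQuadraticForm q) : IsQuadraticForm p where
  ne_bot f := by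
    by_cases hf : f ∈ S
    · rw [hp.eq_of_mem f hf]
      exact hq.ne_bot f
    · rw [hp.eq_top f hf]
      exact top_ne_bot
  smul c f := by
    by_cases hf : f ∈ S
    · rw [hp.eq_of_mem f hf, hp.eq_of_mem _ (S.smul_mem c hf), hq.smul]
    · rw [hp.eq_top f hf]
      rcases eq_or_ne c 0 with rfl | hc
      · rw [zero_smul, hp.eq_of_mem 0 S.zero_mem, hq.map_zero]
        simp
      · rw [hp.eq_top _ (fun h => hf ((S.smul_mem_iff hc).1 h)), EReal.coe_mul_top_of_pos]
        positivity
  parallelogram f g := by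
    have hbot : ∀ f, p f ≠ ⊥ := by
      intro f
      by_cases hf : f ∈ S
      · rw [hp.eq_of_mem f hf]
        exact hq.ne_bot f
      · rw [hp.eq_top f hf]
        exact top_ne_bot
    have hbot2 : ∀ f, 2 * p f ≠ ⊥ := by
      intro f
      rw [show (2 : EReal) = ((2 : ℝ) : EReal) from rfl]
      by_cases h : p f = ⊤
      · rw [h, EReal.coe_mul_top_of_pos two_pos]
        exact top_ne_bot
      · rw [← EReal.coe_toReal h (hbot f), ← EReal.coe_mul]
        exact EReal.coe_ne_bot _
    have htop : ∀ f ∉ S, 2 * p f = ⊤ := by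
      intro f hf
      rw [hp.eq_top f hf, show (2 : EReal) = ((2 : ℝ) : EReal) from rfl,
        EReal.coe_mul_top_of_pos two_pos]
    by_cases h1 : f + g ∈ S
    · by_cases h2 : f - g ∈ S
      · have hf : f ∈ S := by
          have h3 := S.smul_mem (1 / 2 : ℝ) (S.add_mem h1 h2)
          have h4 : (1 / 2 : ℝ) • (f + g + (f - g)) = f := by module
          rwa [h4] at h3
        have hg : g ∈ S := by
          have h3 := S.sub_mem h1 hf
          rwa [add_sub_cancel_left] at h3
        rw [hp.eq_of_mem _ h1, hp.eq_of_mem _ h2, hp.eq_of_mem _ hf, hp.eq_of_mem _ hg,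
          hq.parallelogram]
      · rw [hp.eq_top _ h2, EReal.add_top_of_ne_bot (hbot _)]
        by_cases hf : f ∈ S
        · have hg : g ∉ S := fun hg => h2 (S.sub_mem hf hg)
          rw [htop g hg, EReal.add_top_of_ne_bot (hbot2 _)]
        · rw [htop f hf, EReal.top_add_of_ne_bot (hbot2 _)]
    · rw [hp.eq_top _ h1, EReal.top_add_of_ne_bot (hbot _)]
      by_cases hf : f ∈ S
      · have hg : g ∉ S := fun hg => h1 (S.add_mem hf hg)
        rw [htop g hg, EReal.add_top_of_ne_bot (hbot2 _)]
      · rw [htop f hf, EReal.top_add_of_ne_bot (hbot2 _)]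

theorem isFormCauchy {u : ℕ → E} (hu : IsFormCauchy p u) : IsFormCauchy q u := by
  have hS : ∀ n, u n ∈ S := fun n => hp.mem_iff.1 (hu.1 n)
  exact ⟨fun n => hp.le_domain _ (hS n), hu.2.1,
    hu.2.2.congr (fun n => hp.eq_of_mem _ (S.sub_mem (hS _) (hS _)))⟩

end IsFormRestriction

variable {α : ℝ}

/-- The closure of a subspace `S` in the form norm. -/
noncomputable def IsShift.closure (hq : IsShift q α) (S : Submodule ℝ E) : Submodule ℝ E :=
  ((S.comap FormSpace.incl).topologicalClosure : Submodule ℝ (FormSpace hq)).map FormSpace.incl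

variable {S : Submodule ℝ E} (hq : IsShift q α)

theorem IsShift.mem_closure_iff {f : E} : f ∈ hq.closure S ↔ ∃ u : ℕ → FormSpace hq,
    (∀ n, FormSpace.incl (u n) ∈ S) ∧ ∃ v : FormSpace hq, Tendsto u atTop (𝓝 v) ∧
      FormSpace.incl v = f := by
  rw [IsShift.closure, Submodule.mem_map]
  constructor
  · rintro ⟨v, hv, rfl⟩
    obtain ⟨u, hu, hlim⟩ := mem_closure_iff_seq_limit.1 hv
    exact ⟨u, hu, v, hlim, rfl⟩
  · rintro ⟨u, hu, v, hlim, rfl⟩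
    exact ⟨v, mem_closure_iff_seq_limit.2 ⟨u, hu, hlim⟩, rfl⟩

theorem IsShift.mem_formDomain_of_mem_closure {f : E} (hf : f ∈ hq.closure S) :
    f ∈ formDomain q := by
  obtain ⟨v, -, rfl⟩ := hf
  exact FormSpace.incl_mem v

theorem IsShift.le_closure (hS : ∀ f ∈ S, f ∈ formDomain q) : S ≤ hq.closure S := fun f hf =>
  ⟨FormSpace.mk f (hS f hf), Submodule.le_topologicalClosure _ hf, rfl⟩

/-- The closure of the restriction of a closed form to a subspace is the restriction of the form to
the closure of the subspace in the form norm. -/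
theorem IsFormRestriction.formClosure (hp : IsFormRestriction p q S) :
    IsFormRestriction (formClosure p) q (hq.closure S) := by
  -- Completeness of `q` identifies every admissible limit value as `q f`, so the infimum defining
  -- the closure runs over at most one number.
  have key : ∀ (f : E) (c : EReal) (u : ℕ → E), IsFormCauchy p u → Tendsto u atTop (𝓝 f) →
      Tendsto (fun n => p (u n)) atTop (𝓝 c) → f ∈ hq.closure S ∧ c = q f := by
    intro f c u hu h1 h2
    have hS : ∀ n, u n ∈ S := fun n => hp.mem_iff.1 (hu.1 n)
    obtain ⟨f', hf', h3, h4⟩ := hq.closed.complete u (hp.isFormCauchy hu)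
    obtain rfl := tendsto_nhds_unique h1 h3
    refine ⟨hq.mem_closure_iff.2 ⟨fun n => FormSpace.mk (u n) (hp.le_domain _ (hS n)), hS,
      FormSpace.mk f hf', FormSpace.tendsto_iff.2 ⟨h1, h4⟩, rfl⟩, ?_⟩
    have h5 := (hq.closed.isFormCauchy_of_tendsto (fun n => hp.le_domain _ (hS n)) hf' h1 h4).2
    exact tendsto_nhds_unique (h2.congr (fun n => hp.eq_of_mem _ (hS n))) h5
  refine ⟨fun f => hq.mem_formDomain_of_mem_closure, fun f hf => ?_, fun f hf => ?_⟩
  · rw [DiscreteSchrodinger.formClosure]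
    obtain ⟨u, hu, v, hlim, rfl⟩ := hq.mem_closure_iff.1 hf
    refine le_antisymm (sInf_le ⟨fun n => FormSpace.incl (u n), ?_,
      (FormSpace.tendsto_iff.1 hlim).1, ?_⟩) (le_sInf ?_)
    · have h := FormSpace.isFormCauchy_iff.2 hlim.cauchySeq
      refine ⟨fun n => hp.mem_iff.2 (hu n), h.2.1, h.2.2.congr (fun n => ?_)⟩
      exact (hp.eq_of_mem _ (S.sub_mem (hu _) (hu _))).symm
    · exact (FormSpace.tendsto_form hlim).congr (fun n => (hp.eq_of_mem _ (hu n)).symm)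
    · rintro c ⟨w, hw, h1, h2⟩
      exact (key _ c w hw h1 h2).2.ge
  · rw [DiscreteSchrodinger.formClosure, sInf_eq_top]
    rintro c ⟨u, hu, h1, h2⟩
    exact absurd (key f c u hu h1 h2).1 hf

/-- The closure of the restriction of a closed form to a dense subspace is closed. -/
theorem IsFormRestriction.isClosedForm (hp : IsFormRestriction p q (hq.closure S))
    (hS : ∀ f ∈ S, f ∈ formDomain q) (hd : Dense (S : Set E)) : IsClosedForm p where
  isQuadraticForm := hp.isQuadraticForm hq.closed.isQuadraticForm
  dense := hd.mono (fun f hf => hp.mem_iff.2 (hq.le_closure hS hf))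
  lowerSemibounded := by
    obtain ⟨C, hC⟩ := hq.closed.lowerSemibounded
    refine ⟨C, fun f => ?_⟩
    by_cases hf : f ∈ hq.closure S
    · rw [hp.eq_of_mem f hf]
      exact hC f
    · rw [hp.eq_top f hf]
      exact le_top
  complete u hu := by
    have hu' := hp.isFormCauchy hu
    have hmem : ∀ n, u n ∈ hq.closure S := fun n => hp.mem_iff.1 (hu.1 n)
    obtain ⟨f, hf, h1, h2⟩ := hq.closed.complete u hu'
    have hcl : f ∈ hq.closure S := by
      refine ⟨FormSpace.mk f hf, ?_, rfl⟩
      refine (Submodule.isClosed_topologicalClosure _).mem_of_tendsto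
        (f := fun n => (FormSpace.mk (u n) (hu'.1 n) : FormSpace hq)) (b := atTop)
        (FormSpace.tendsto_iff.2 ⟨h1, h2⟩) (Eventually.of_forall fun n => ?_)
      obtain ⟨v, hv, hvn⟩ := hmem n
      have : v = FormSpace.mk (u n) (hu'.1 n) := FormSpace.incl_injective hvn
      rwa [← this]
    exact ⟨f, hp.mem_iff.2 hcl, h1, h2.congr (fun n =>
      (hp.eq_of_mem _ (Submodule.sub_mem _ (hmem n) hcl)).symm)⟩

variable [CompleteSpace E] in
/-- Limits in the Hilbert space of form-bounded sequences in a subspace belong to its closure in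
the form norm. -/
theorem IsShift.mem_closure_of_bounded {v : ℕ → E} {f : E} {C : ℝ}
    (hS : ∀ f ∈ S, f ∈ formDomain q) (hv : ∀ n, v n ∈ S) (hf : f ∈ formDomain q)
    (hC : ∀ n, (q (v n)).toReal ≤ C) (hlim : Tendsto v atTop (𝓝 f)) : f ∈ hq.closure S := by
  refine ⟨FormSpace.mk f hf, ?_, rfl⟩
  obtain ⟨M, hM⟩ := (hlim.norm).bddAbove_range
  have hM' : ∀ n, ‖v n‖ ≤ M := fun n => hM ⟨n, rfl⟩
  have hC0 : ∀ n, ‖(FormSpace.mk (v n) (hS _ (hv n)) : FormSpace hq)‖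
      ≤ Real.sqrt (|C| + |α| * M ^ 2) := by
    intro n
    refine Real.le_sqrt_of_sq_le ?_
    rw [FormSpace.norm_sq_def, FormSpace.incl_mk]
    have h1 : α * ‖v n‖ ^ 2 ≤ |α| * M ^ 2 := by
      have : ‖v n‖ ^ 2 ≤ M ^ 2 := by
        have := hM' n
        gcongr
      calc α * ‖v n‖ ^ 2 ≤ |α| * ‖v n‖ ^ 2 := by gcongr; exact le_abs_self α
        _ ≤ _ := by gcongr
    linarith [hC n, le_abs_self C]
  exact FormSpace.mem_closure_of_bounded (v := fun n => FormSpace.mk (v n) (hS _ (hv n)))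
    (fun n => hv n) hC0 hlim

end Restriction

/-! ### Forms that are sums of squares of continuous functionals -/

section SumForm

variable {E : Type*} [NormedAddCommGroup E] [InnerProductSpace ℝ E] {I : Type*}

/-- The form `f ↦ ∑ i, (L i f) ^ 2`. -/
noncomputable def sumForm (L : I → E →L[ℝ] ℝ) (f : E) : EReal :=
  ((∑' i, ENNReal.ofReal (L i f ^ 2) : ENNReal) : EReal)

variable (L : I → E →L[ℝ] ℝ)

theorem mem_sumForm_iff {f : E} : f ∈ formDomain (sumForm L) ↔ Summable (fun i => L i f ^ 2) := by
  rw [formDomain, Set.mem_ofPred_eq, sumForm, Ne, EReal.coe_ennreal_eq_top_iff]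
  constructor
  · intro h
    have h1 := ENNReal.summable_toReal h
    simpa [ENNReal.toReal_ofReal (sq_nonneg _)] using h1
  · intro h
    exact h.tsum_ofReal_ne_top

theorem sumForm_eq {f : E} (hf : Summable (fun i => L i f ^ 2)) :
    sumForm L f = ((∑' i, L i f ^ 2 : ℝ) : EReal) := by
  rw [sumForm, ← ENNReal.ofReal_tsum_of_nonneg (fun i => sq_nonneg _) hf,
    EReal.coe_ennreal_ofReal, max_eq_left (tsum_nonneg (fun i => sq_nonneg _))]

theorem sumForm_nonneg (f : E) : 0 ≤ sumForm L f := EReal.coe_ennreal_nonneg _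

theorem sumForm_isQuadraticForm : IsQuadraticForm (sumForm L) where
  ne_bot f := EReal.coe_ennreal_ne_bot _
  smul c f := by
    have h : ((c ^ 2 : ℝ) : EReal) = ((ENNReal.ofReal (c ^ 2) : ENNReal) : EReal) := by
      rw [EReal.coe_ennreal_ofReal, max_eq_left (sq_nonneg c)]
    rw [sumForm, sumForm, h, ← EReal.coe_ennreal_mul, ← ENNReal.tsum_mul_left]
    congr 1
    refine tsum_congr (fun i => ?_)
    rw [← ENNReal.ofReal_mul (sq_nonneg c), map_smul, smul_eq_mul, mul_pow]
  parallelogram f g := by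
    have h : (2 : EReal) = ((2 : ENNReal) : EReal) := rfl
    rw [sumForm, sumForm, sumForm, sumForm, h, ← EReal.coe_ennreal_mul, ← EReal.coe_ennreal_mul,
      ← EReal.coe_ennreal_add, ← EReal.coe_ennreal_add, ← ENNReal.tsum_mul_left,
      ← ENNReal.tsum_mul_left, ← ENNReal.tsum_add, ← ENNReal.tsum_add]
    congr 1
    refine tsum_congr (fun i => ?_)
    have h2 : (2 : ENNReal) = ENNReal.ofReal 2 := by simp
    rw [h2, ← ENNReal.ofReal_mul zero_le_two, ← ENNReal.ofReal_mul zero_le_two,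
      ← ENNReal.ofReal_add (sq_nonneg _) (sq_nonneg _),
      ← ENNReal.ofReal_add (by positivity) (by positivity), map_add, map_sub]
    congr 1
    ring

/-- Sum forms are lower semi-continuous. -/
theorem sumForm_le_of_tendsto {ι : Type*} {l : Filter ι} [l.NeBot] {u : ι → E} {f : E} {C : EReal}
    (hu : Tendsto u l (𝓝 f)) (hC : ∀ᶠ n in l, sumForm L (u n) ≤ C) : sumForm L f ≤ C := by
  have hC0 : 0 ≤ C := by
    obtain ⟨n, hn⟩ := hC.exists
    exact (sumForm_nonneg L _).trans hn
  rw [← EReal.coe_toENNReal hC0, sumForm, EReal.coe_ennreal_le_coe_ennreal_iff,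
    ENNReal.tsum_eq_iSup_sum]
  refine iSup_le (fun s => ?_)
  have h1 : Tendsto (fun n => ∑ i ∈ s, ENNReal.ofReal (L i (u n) ^ 2)) l
      (𝓝 (∑ i ∈ s, ENNReal.ofReal (L i f ^ 2))) := by
    refine tendsto_finsetSum _ (fun i _ => ENNReal.tendsto_ofReal ?_)
    exact (((L i).continuous.tendsto f).comp hu).pow 2
  refine le_of_tendsto h1 (hC.mono (fun n hn => ?_))
  rw [← EReal.coe_toENNReal hC0, sumForm, EReal.coe_ennreal_le_coe_ennreal_iff] at hn
  exact (ENNReal.sum_le_tsum s).trans hn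

/-- Closedness follows from lower semicontinuity: let `m → ∞` in a bound on the form at `u n - u m`,
where `u m` converges in `E`. -/
theorem sumForm_isClosedForm [CompleteSpace E] (hd : Dense (formDomain (sumForm L))) :
    IsClosedForm (sumForm L) where
  isQuadraticForm := sumForm_isQuadraticForm L
  dense := hd
  lowerSemibounded := ⟨0, fun f => by simpa using sumForm_nonneg L f⟩
  complete u hu := by
    obtain ⟨hu1, hu2, hu3⟩ := hu
    obtain ⟨f, hf⟩ := cauchySeq_tendsto_of_complete hu2
    have key : ∀ ε : EReal, 0 < ε → ∃ N, ∀ n ≥ N, sumForm L (u n - f) ≤ ε := by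
      intro ε hε
      have h1 := hu3.eventually (gt_mem_nhds hε)
      rw [eventually_atTop] at h1
      obtain ⟨⟨N, M⟩, hNM⟩ := h1
      refine ⟨N, fun n hn => ?_⟩
      refine sumForm_le_of_tendsto L (l := atTop) (u := fun m => u n - u m)
        (tendsto_const_nhds.sub hf) ?_
      filter_upwards [eventually_ge_atTop M] with m hm
      exact (hNM (n, m) ⟨hn, hm⟩).le
    have hfmem : f ∈ formDomain (sumForm L) := by
      obtain ⟨N, hN⟩ := key 1 zero_lt_one
      have h1 : u N - f ∈ formDomain (sumForm L) := by
        refine ne_top_of_le_ne_top ?_ (hN N le_rfl)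
        exact EReal.coe_ne_top 1
      have h2 := (sumForm_isQuadraticForm L).sub_mem (hu1 N) h1
      rwa [sub_sub_cancel] at h2
    refine ⟨f, hfmem, hf, ?_⟩
    rw [tendsto_order]
    constructor
    · intro a ha
      exact Eventually.of_forall (fun n => ha.trans_le (sumForm_nonneg L _))
    · intro a ha
      obtain ⟨b, hb0, hba⟩ := exists_between ha
      obtain ⟨N, hN⟩ := key b hb0
      filter_upwards [eventually_ge_atTop N] with n hn
      exact (hN n hn).trans_lt hba

theorem polarForm_sumForm {f g : E} (hf : f ∈ formDomain (sumForm L))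
    (hg : g ∈ formDomain (sumForm L)) :
    polarForm (sumForm L) f g = ∑' i, L i f * L i g := by
  have h1 := (sumForm_isQuadraticForm L).add_mem hf hg
  have h2 := (sumForm_isQuadraticForm L).sub_mem hf hg
  rw [mem_sumForm_iff] at h1 h2
  rw [polarForm, sumForm_eq L h1, sumForm_eq L h2, EReal.toReal_coe, EReal.toReal_coe,
    ← h1.tsum_sub h2, ← tsum_div_const]
  refine tsum_congr (fun i => ?_)
  rw [map_add, map_sub]
  ring

end SumForm

variable {X : Type*}

/-! ### Point evaluations and finitely supported functions -/

namespace Ell2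

variable {μ : Weight X}

theorem sq_mul_le_norm_sq (f : Ell2 μ) (x : X) : f x ^ 2 * μ x ≤ ‖f‖ ^ 2 := by
  rw [norm_sq_def]
  exact f.summable_sq.le_tsum x (fun y _ => mul_nonneg (sq_nonneg _) (μ.pos y).le)

/-- The evaluation at a point. -/
noncomputable def eval (x : X) : Ell2 μ →L[ℝ] ℝ :=
  LinearMap.mkContinuous
    { toFun := fun f => f x
      map_add' := fun f g => add_apply f g x
      map_smul' := fun c f => smul_apply c f x } (Real.sqrt (μ x))⁻¹ (fun f => by
    change |f x| ≤ _
    have h := Real.sqrt_pos.2 (μ.pos x)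
    rw [inv_mul_eq_div, le_div_iff₀ h]
    refine le_of_sq_le_sq ?_ (norm_nonneg _)
    rw [mul_pow, sq_abs, Real.sq_sqrt (μ.pos x).le]
    exact sq_mul_le_norm_sq f x)

theorem tendsto_apply {ι : Type*} {l : Filter ι} {u : ι → Ell2 μ} {f : Ell2 μ}
    (h : Tendsto u l (𝓝 f)) (x : X) : Tendsto (fun n => u n x) l (𝓝 (f x)) :=
  ((eval x).continuous.tendsto f).comp h

theorem sum_apply {ι : Type*} (s : Finset ι) (u : ι → Ell2 μ) (x : X) :
    (∑ i ∈ s, u i) x = ∑ i ∈ s, u i x := map_sum (eval x) u s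

open Classical in
/-- The characteristic function of a finite set. -/
noncomputable def indicator (s : Finset X) : Ell2 μ :=
  mk (fun y => if y ∈ s then 1 else 0) (summable_of_ne_finset_zero (s := s) (fun y hy => by
    simp [hy]))

/-- The characteristic function of a point. -/
noncomputable def delta (x : X) : Ell2 μ := indicator {x}

open Classical in
theorem indicator_apply (s : Finset X) (y : X) :
    (indicator s : Ell2 μ) y = if y ∈ s then 1 else 0 := rfl

open Classical in
theorem delta_apply (x y : X) : (delta x : Ell2 μ) y = if y = x then 1 else 0 := by
  rw [delta, indicator_apply]
  simp

theorem indicator_eq_sum (s : Finset X) : (indicator s : Ell2 μ) = ∑ x ∈ s, delta x := by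
  classical
  ext y
  simp [sum_apply, indicator_apply, delta_apply]

theorem inner_delta (f : Ell2 μ) (x : X) : inner ℝ f (delta x) = f x * μ x := by
  rw [inner_def, tsum_eq_single x (fun y hy => by simp [delta_apply, hy])]
  simp [delta_apply]

end Ell2

open Ell2

variable {μ : Weight X}

variable (μ) in
/-- The finitely supported functions, as a subspace. -/
def finSuppSubmodule : Submodule ℝ (Ell2 μ) where
  carrier := finSupp μ
  zero_mem' := by
    change (Function.support (fun _ : X => (0 : ℝ))).Finite
    simp
  add_mem' := fun {f g} hf hg => (hf.union hg).subset (Function.support_add (fun x => f x) _)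
  smul_mem' := fun c f hf => hf.subset (fun x hx => by
    simp only [smul_apply, Function.mem_support, ne_eq, mul_eq_zero, not_or] at hx ⊢
    exact hx.2)

theorem mem_finSupp_of_eq_zero {f : Ell2 μ} (s : Finset X) (h : ∀ x ∉ s, f x = 0) :
    f ∈ finSuppSubmodule μ :=
  s.finite_toSet.subset (fun x hx => by
    by_contra hxs
    exact hx (h x hxs))

theorem delta_mem_finSupp (x : X) : delta x ∈ finSuppSubmodule μ := by
  classical
  refine mem_finSupp_of_eq_zero {x} (fun y hy => ?_)
  rw [Finset.mem_singleton] at hy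
  rw [delta_apply, if_neg hy]

theorem indicator_mem_finSupp (s : Finset X) : indicator s ∈ finSuppSubmodule μ := by
  classical
  refine mem_finSupp_of_eq_zero s (fun y hy => ?_)
  rw [indicator_apply, if_neg hy]

theorem exists_eq_sum_delta {f : Ell2 μ} (hf : f ∈ finSuppSubmodule μ) :
    ∃ s : Finset X, f = ∑ x ∈ s, f x • delta x := by
  classical
  refine ⟨Set.Finite.toFinset hf, ?_⟩
  ext y
  simp only [sum_apply, smul_apply, delta_apply, mul_ite, mul_one, mul_zero, Finset.sum_ite_eq]
  split_ifs with h
  · rfl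
  · by_contra h0
    exact h ((Set.Finite.mem_toFinset hf).2 h0)

theorem finSuppSubmodule_le {S : Submodule ℝ (Ell2 μ)} (h : ∀ x, delta x ∈ S) :
    finSuppSubmodule μ ≤ S := by
  intro f hf
  obtain ⟨s, hs⟩ := exists_eq_sum_delta hf
  rw [hs]
  exact Submodule.sum_mem _ (fun x _ => S.smul_mem _ (h x))

theorem dense_finSupp : Dense (finSuppSubmodule μ : Set (Ell2 μ)) := by
  rw [Submodule.dense_iff_topologicalClosure_eq_top, Submodule.topologicalClosure_eq_top_iff,
    Submodule.eq_bot_iff]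
  intro f hf
  ext x
  have h := (Submodule.mem_orthogonal' _ _).1 hf _ (delta_mem_finSupp x)
  rw [inner_delta] at h
  exact (mul_eq_zero.1 h).resolve_right (μ.pos x).ne'

/-! ### The Schrödinger form as a sum of squares -/

theorem hasSum_row {F : X → ℝ} {s : ℝ} (x : X) [DecidableEq X] (h : HasSum F s) :
    HasSum (fun p : X × X => if p.1 = x then F p.2 else 0) s := by
  rw [← (Prod.mk_right_injective x).hasSum_iff]
  · simpa [Function.comp_def] using h
  · rintro ⟨y, z⟩ hp
    rw [if_neg]
    rintro rfl
    exact hp ⟨z, rfl⟩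

theorem hasSum_column {F : X → ℝ} {s : ℝ} (x : X) [DecidableEq X] (h : HasSum F s) :
    HasSum (fun p : X × X => if p.2 = x then F p.1 else 0) s := by
  rw [← (Prod.mk_left_injective x).hasSum_iff]
  · simpa [Function.comp_def] using h
  · rintro ⟨y, z⟩ hp
    rw [if_neg]
    rintro rfl
    exact hp ⟨y, rfl⟩

/-- The functionals whose squares add up to the Schrödinger form. -/
noncomputable def gradient (G : WeightedGraph X) (μ : Weight X) (V : X → ℝ) :
    (X × X) ⊕ X → Ell2 μ →L[ℝ] ℝ
  | .inl p => Real.sqrt (G.b p.1 p.2 / 2) • (eval p.1 - eval p.2)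
  | .inr x => Real.sqrt (V x * μ x) • eval x

variable {G : WeightedGraph X} {V : X → ℝ}

theorem gradient_inl_mul (p : X × X) (f g : Ell2 μ) :
    gradient G μ V (.inl p) f * gradient G μ V (.inl p) g
      = 1 / 2 * (G.b p.1 p.2 * ((f p.1 - f p.2) * (g p.1 - g p.2))) := by
  have h := Real.mul_self_sqrt (div_nonneg (G.nonneg p.1 p.2) zero_le_two)
  change Real.sqrt (G.b p.1 p.2 / 2) * (f p.1 - f p.2) *
    (Real.sqrt (G.b p.1 p.2 / 2) * (g p.1 - g p.2)) = _
  linear_combination (f p.1 - f p.2) * (g p.1 - g p.2) * h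

section Nonneg

variable (hV : ∀ x, 0 ≤ V x)
include hV

/-- The sign of `V` matters here: `Real.sqrt` is `0` at negative arguments. -/
theorem gradient_inr_mul (x : X) (f g : Ell2 μ) :
    gradient G μ V (.inr x) f * gradient G μ V (.inr x) g = V x * (f x * g x) * μ x := by
  have h := Real.mul_self_sqrt (mul_nonneg (hV x) (μ.pos x).le)
  change Real.sqrt (V x * μ x) * f x * (Real.sqrt (V x * μ x) * g x) = _
  linear_combination f x * g x * h

theorem mem_finiteEnergy_iff (f : Ell2 μ) : (fun x => f x) ∈ finiteEnergy G μ V ↔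
    Summable (fun i => gradient G μ V i f ^ 2) := by
  have h1 : ∀ p : X × X, gradient G μ V (.inl p) f ^ 2
      = 1 / 2 * (G.b p.1 p.2 * (f p.1 - f p.2) ^ 2) := fun p => by
    rw [sq, gradient_inl_mul, ← sq]
  have h2 : ∀ x, gradient G μ V (.inr x) f ^ 2 = |V x| * f x ^ 2 * μ x := fun x => by
    rw [sq, gradient_inr_mul hV, abs_of_nonneg (hV x), ← sq]
  constructor
  · rintro ⟨h3, h4⟩
    refine Summable.sum _ ?_ ?_
    · exact (h3.mul_left (1 / 2)).congr (fun p => (h1 p).symm)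
    · exact h4.congr (fun x => (h2 x).symm)
  · intro h
    have h3 := (h.comp_injective Sum.inl_injective).mul_left 2
    have h4 := h.comp_injective Sum.inr_injective
    refine ⟨h3.congr (fun p => ?_), h4.congr h2⟩
    simp only [Function.comp_apply, h1]
    ring

theorem QN_eq_sumForm : QN G μ V = sumForm (gradient G μ V) := by
  ext f
  by_cases hf : (fun x => f x) ∈ finiteEnergy G μ V
  · rw [QN, if_pos hf, sumForm_eq _ ((mem_finiteEnergy_iff hV f).1 hf)]
    congr 1
    have h1 : HasSum ((fun i => gradient G μ V i f ^ 2) ∘ Sum.inl)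
        (1 / 2 * ∑' p : X × X, G.b p.1 p.2 * (f p.1 - f p.2) ^ 2) := by
      refine (hf.1.hasSum.mul_left (1 / 2)).congr_fun (fun p => ?_)
      change gradient G μ V (.inl p) f ^ 2 = 1 / 2 * (G.b p.1 p.2 * (f p.1 - f p.2) ^ 2)
      rw [sq, gradient_inl_mul, ← sq]
    have h2 : HasSum ((fun i => gradient G μ V i f ^ 2) ∘ Sum.inr)
        (∑' x, V x * f x ^ 2 * μ x) := by
      have h3 : Summable (fun x => V x * f x ^ 2 * μ x) :=
        hf.2.congr (fun x => by rw [abs_of_nonneg (hV x)])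
      refine h3.hasSum.congr_fun (fun x => ?_)
      change gradient G μ V (.inr x) f ^ 2 = V x * f x ^ 2 * μ x
      rw [sq, gradient_inr_mul hV, ← sq]
    exact (HasSum.sum h1 h2).tsum_eq.symm
  · have h1 : f ∉ formDomain (sumForm (gradient G μ V)) := by
      rwa [mem_sumForm_iff, ← mem_finiteEnergy_iff hV]
    rw [QN, if_neg hf]
    exact (not_not.1 h1).symm

theorem delta_mem_formDomain (x : X) : delta x ∈ formDomain (sumForm (gradient G μ V)) := by
  classical
  rw [mem_sumForm_iff, ← mem_finiteEnergy_iff hV]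
  constructor
  · have h1 := hasSum_row x (G.summable x).hasSum
    have h2 := hasSum_column x (G.summable x).hasSum
    refine Summable.of_nonneg_of_le (fun p => mul_nonneg (G.nonneg _ _) (sq_nonneg _))
      (fun p => ?_) (h1.summable.add h2.summable)
    have h3 := G.nonneg p.1 p.2
    have h4 := G.symm p.1 p.2
    simp only [delta_apply]
    split_ifs with e1 e2 e2
    · simp only [← e1]
      rw [sub_self, zero_pow two_ne_zero, mul_zero]
      exact add_nonneg (G.nonneg _ _) (G.nonneg _ _)
    · simp [← e1]
    · simp [← e2, h4]
    · simp
  · refine summable_of_ne_finset_zero (s := {x}) (fun y hy => ?_)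
    rw [Finset.mem_singleton] at hy
    simp [delta_apply, hy]

theorem finSupp_le_formDomain (f : Ell2 μ) (hf : f ∈ finSuppSubmodule μ) :
    f ∈ formDomain (sumForm (gradient G μ V)) :=
  finSuppSubmodule_le (S := (sumForm_isQuadraticForm (gradient G μ V)).domain)
    (delta_mem_formDomain hV) hf

theorem isClosedForm_sumForm_gradient : IsClosedForm (sumForm (gradient G μ V)) :=
  sumForm_isClosedForm _ (dense_finSupp.mono (finSupp_le_formDomain hV))

end Nonneg

theorem summable_mul_sub {f : X → ℝ} (hf : f ∈ formalDomain G) (x : X) :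
    Summable (fun y => G.b x y * (f x - f y)) := by
  refine Summable.of_norm_bounded (((G.summable x).mul_right |f x|).add (hf x)) (fun y => ?_)
  rw [Real.norm_eq_abs, abs_mul, abs_of_nonneg (G.nonneg x y), ← mul_add]
  exact mul_le_mul_of_nonneg_left (abs_sub _ _) (G.nonneg x y)

/-- From `|t| ≤ 1 + t ^ 2` with `t = f x - f y` one gets `|f y| ≤ |f x| + 1 + (f x - f y) ^ 2`, and
each term is summable against `b x ·`. -/
theorem finiteEnergy_subset_formalDomain : finiteEnergy G μ V ⊆ formalDomain G := by
  intro f hf x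
  have h1 : Summable (fun y => G.b x y * (f x - f y) ^ 2) :=
    hf.1.comp_injective (Prod.mk_right_injective x)
  refine Summable.of_nonneg_of_le (fun y => mul_nonneg (G.nonneg x y) (abs_nonneg _)) (fun y => ?_)
    (((G.summable x).mul_right (|f x| + 1)).add h1)
  rw [← mul_add]
  refine mul_le_mul_of_nonneg_left ?_ (G.nonneg x y)
  have h2 : |f y| ≤ |f x| + |f x - f y| := by
    have := abs_sub_abs_le_abs_sub (f y) (f x)
    rw [abs_sub_comm] at this
    linarith
  nlinarith [sq_abs (f x - f y), sq_nonneg (|f x - f y| - 1), abs_nonneg (f x - f y)]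

theorem mul_formalOperator (f : X → ℝ) (x : X) : μ x * formalOperator G μ V f x =
    ∑' y, G.b x y * (f x - f y) + V x * μ x * f x := by
  have h := (μ.pos x).ne'
  rw [formalOperator]
  field_simp

/-- Green's formula against a point mass. Only pairs in row `x` or column `x` contribute; by
symmetry of `b` each gives half of the sum, which cancels the factor `1 / 2`. -/
theorem polarForm_delta (hV : ∀ x, 0 ≤ V x) {f : Ell2 μ}
    (hf : f ∈ formDomain (sumForm (gradient G μ V))) (x : X) :
    polarForm (sumForm (gradient G μ V)) f (delta x)
      = μ x * formalOperator G μ V (fun y => f y) x := by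
  classical
  have hf' : (fun y => f y) ∈ formalDomain G := finiteEnergy_subset_formalDomain
    ((mem_finiteEnergy_iff hV f).2 ((mem_sumForm_iff _).1 hf))
  rw [polarForm_sumForm _ hf (delta_mem_formDomain hV x), mul_formalOperator]
  refine HasSum.tsum_eq (HasSum.sum ?_ ?_)
  · have h0 := (summable_mul_sub hf' x).hasSum.mul_left (1 / 2)
    have h1 := (hasSum_row x h0).add (hasSum_column x h0)
    rw [← add_mul, add_halves, one_mul] at h1
    convert h1 using 1
    ext p
    simp only [Function.comp_apply]
    rw [gradient_inl_mul, delta_apply, delta_apply]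
    split_ifs with e1 e2 e2
    · rw [← e1, e2, ← e1]
      ring
    · rw [← e1]
      ring
    · rw [← e2, G.symm p.1 p.2]
      ring
    · ring
  · convert hasSum_ite_eq x (V x * μ x * f x) using 1
    ext y
    simp only [Function.comp_apply]
    rw [gradient_inr_mul hV, delta_apply]
    split_ifs with e
    · rw [e]
      ring
    · ring

/-! ### Markovian realizations from restrictions of the Schrödinger form -/

/-- Testing the form identity with `delta x` recovers the value of the operator at `x`, and Green's
formula identifies it with the formal operator. -/
theorem isRealization_operator (hV : ∀ x, 0 ≤ V x) {p : Ell2 μ → EReal}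
    {S : Submodule ℝ (Ell2 μ)} (hp : IsFormRestriction p (sumForm (gradient G μ V)) S)
    (hS : finSuppSubmodule μ ≤ S) (hcl : IsClosedForm p) : IsRealization G μ V hcl.operator := by
  have hform := hcl.isFormOf_operator
  have hmem : ∀ f : hcl.operator.domain, (f : Ell2 μ) ∈ S := fun f =>
    hp.mem_iff.1 (hform.mem_of_mem_domain f.2)
  refine ⟨hcl.operator_isSelfAdjoint, ⟨0, fun f => ?_⟩, ⟨p, hform, fun f hf =>
    hp.mem_iff.2 (hS hf)⟩, fun f => ?_, fun f x => ?_⟩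
  · rw [zero_mul, ← hform.polarForm_eq f (hp.mem_iff.2 (hmem f)), hcl.polarForm_self,
      hp.eq_of_mem _ (hmem f)]
    exact EReal.toReal_nonneg (sumForm_nonneg _ _)
  · exact finiteEnergy_subset_formalDomain
      ((mem_finiteEnergy_iff hV _).2 ((mem_sumForm_iff _).1 (hp.le_domain _ (hmem f))))
  · have hx := hS (delta_mem_finSupp x)
    have h1 := hform.polarForm_eq f (hp.mem_iff.2 hx)
    have h2 : polarForm p (f : Ell2 μ) (delta x)
        = polarForm (sumForm (gradient G μ V)) (f : Ell2 μ) (delta x) := by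
      rw [polarForm, polarForm, hp.eq_of_mem _ (S.add_mem (hmem f) hx),
        hp.eq_of_mem _ (S.sub_mem (hmem f) hx)]
    rw [h2, polarForm_delta hV (hp.le_domain _ (hmem f)), inner_delta, mul_comm] at h1
    exact (mul_right_cancel₀ (μ.pos x).ne' h1).symm

theorem sumForm_comp_le (hV : ∀ x, 0 ≤ V x) {C : ℝ → ℝ} (hC : IsNormalContraction C)
    (f : Ell2 μ) : sumForm (gradient G μ V) (Ell2.comp C hC.abs_le f)
      ≤ sumForm (gradient G μ V) f := by
  rw [sumForm, sumForm, EReal.coe_ennreal_le_coe_ennreal_iff]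
  refine ENNReal.tsum_le_tsum (fun i => ENNReal.ofReal_le_ofReal ?_)
  rcases i with p | x
  · rw [sq, sq, gradient_inl_mul, gradient_inl_mul, ← sq, ← sq]
    have h1 := G.nonneg p.1 p.2
    have h2 : (C (f p.1) - C (f p.2)) ^ 2 ≤ (f p.1 - f p.2) ^ 2 :=
      sq_le_sq.2 (hC.abs_sub_le _ _)
    change 1 / 2 * (G.b p.1 p.2 * (C (f p.1) - C (f p.2)) ^ 2) ≤ _
    gcongr
  · rw [sq, sq, gradient_inr_mul hV, gradient_inr_mul hV, ← sq, ← sq]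
    have h1 := hV x
    have h2 : C (f x) ^ 2 ≤ f x ^ 2 := sq_le_sq.2 (hC.abs_le _)
    have h3 := (μ.pos x).le
    change V x * C (f x) ^ 2 * μ x ≤ _
    gcongr

theorem isDirichletForm_sumForm (hV : ∀ x, 0 ≤ V x) :
    IsDirichletForm (sumForm (gradient G μ V)) where
  closed := isClosedForm_sumForm_gradient hV
  nonneg := sumForm_nonneg _
  contraction _ hC f hf := ⟨ne_top_of_le_ne_top hf (sumForm_comp_le hV hC f),
    sumForm_comp_le hV hC f⟩

theorem Ell2.norm_comp_sub_le {C : ℝ → ℝ} (hC : IsNormalContraction C) (f g : Ell2 μ) :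
    ‖Ell2.comp C hC.abs_le f - Ell2.comp C hC.abs_le g‖ ≤ ‖f - g‖ := by
  refine le_of_sq_le_sq ?_ (norm_nonneg _)
  rw [norm_sq_def, norm_sq_def]
  refine Summable.tsum_le_tsum (fun x => ?_) (Ell2.summable_sq _) (Ell2.summable_sq _)
  refine mul_le_mul_of_nonneg_right ?_ (μ.pos x).le
  exact sq_le_sq.2 (hC.abs_sub_le _ _)

theorem isShift_sumForm (hV : ∀ x, 0 ≤ V x) : IsShift (sumForm (gradient G μ V)) 1 :=
  (isClosedForm_sumForm_gradient hV).isShift_of_nonneg (sumForm_nonneg _) le_rfl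

theorem isFormRestriction_Q0 (hV : ∀ x, 0 ≤ V x) : IsFormRestriction (Q0 G μ V)
    (sumForm (gradient G μ V)) ((isShift_sumForm (G := G) hV).closure (finSuppSubmodule μ)) := by
  refine IsFormRestriction.formClosure _ ⟨finSupp_le_formDomain hV, fun f hf => ?_, fun f hf => ?_⟩
  · have h1 : (fun x => f x) ∈ finiteEnergy G μ V :=
      (mem_finiteEnergy_iff hV f).2 ((mem_sumForm_iff _).1 (finSupp_le_formDomain hV f hf))
    rw [← QN_eq_sumForm hV, QN, if_pos h1, Qc]
    exact if_pos hf
  · rw [Qc]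
    exact if_neg hf

theorem isClosedForm_Q0 (hV : ∀ x, 0 ≤ V x) : IsClosedForm (Q0 G μ V) :=
  (isFormRestriction_Q0 hV).isClosedForm _ (finSupp_le_formDomain hV) dense_finSupp

/-- Only stability of the domain needs an argument. If finitely supported `u n` converge to `f` in
the form norm, the functions `C ∘ u n` are finitely supported because `C 0 = 0`, have bounded energy
and converge to `C ∘ f` in `ℓ²`; weak closedness puts `C ∘ f` in the closure. -/
theorem isDirichletForm_Q0 (hV : ∀ x, 0 ≤ V x) : IsDirichletForm (Q0 G μ V) where
  closed := isClosedForm_Q0 hV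
  nonneg f := by
    by_cases hf : f ∈ (isShift_sumForm (G := G) hV).closure (finSuppSubmodule μ)
    · rw [(isFormRestriction_Q0 hV).eq_of_mem f hf]
      exact sumForm_nonneg _ _
    · rw [(isFormRestriction_Q0 hV).eq_top f hf]
      exact le_top
  contraction C hC f hf := by
    have hr := isFormRestriction_Q0 (G := G) (μ := μ) hV
    have hs := isShift_sumForm (G := G) (μ := μ) hV
    have hf1 := hr.mem_iff.1 hf
    have hCmem := (isDirichletForm_sumForm (G := G) hV).contraction C hC f (hr.le_domain f hf1)
    have hmem : Ell2.comp C hC.abs_le f ∈ hs.closure (finSuppSubmodule μ) := by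
      obtain ⟨u, hu, v, hlim, rfl⟩ := hs.mem_closure_iff.1 hf1
      have h1 := FormSpace.tendsto_toReal hlim
      obtain ⟨M, hM⟩ := h1.bddAbove_range
      refine hs.mem_closure_of_bounded (C := M)
        (v := fun n => Ell2.comp C hC.abs_le (FormSpace.incl (u n)))
        (finSupp_le_formDomain hV) (fun n => ?_) hCmem.1 (fun n => ?_) ?_
      · refine Set.Finite.subset (hu n) (fun x hx hx0 => hx ?_)
        change C (FormSpace.incl (u n) x) = 0
        change FormSpace.incl (u n) x = 0 at hx0
        rw [hx0, hC.map_zero]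
      · refine le_trans (EReal.toReal_le_toReal (sumForm_comp_le hV hC _)
          ?_ (FormSpace.incl_mem (u n))) (hM ⟨n, rfl⟩)
        exact EReal.coe_ennreal_ne_bot _
      · rw [tendsto_iff_norm_sub_tendsto_zero]
        have h2 := tendsto_iff_norm_sub_tendsto_zero.1 (FormSpace.tendsto_iff.1 hlim).1
        exact squeeze_zero (fun n => norm_nonneg _) (fun n => norm_comp_sub_le hC _ _) h2
    refine ⟨hr.mem_iff.2 hmem, ?_⟩
    rw [hr.eq_of_mem _ hmem, hr.eq_of_mem _ hf1]
    exact hCmem.2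

theorem isMarkovianRealization_Q0 (hV : ∀ x, 0 ≤ V x) :
    IsMarkovianRealization G μ V (isClosedForm_Q0 (G := G) (μ := μ) hV).operator :=
  ⟨isRealization_operator hV (isFormRestriction_Q0 hV)
    ((isShift_sumForm hV).le_closure (finSupp_le_formDomain hV)) _,
    _, IsClosedForm.isFormOf_operator _, isDirichletForm_Q0 hV⟩

theorem isMarkovianRealization_QN (hV : ∀ x, 0 ≤ V x) :
    IsMarkovianRealization G μ V
      (isClosedForm_sumForm_gradient (G := G) (μ := μ) hV).operator := by
  refine ⟨isRealization_operator hV (S := (sumForm_isQuadraticForm (gradient G μ V)).domain)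
    ⟨fun f hf => hf, fun f _ => rfl, fun f hf => not_not.1 hf⟩ (finSupp_le_formDomain hV) _,
    _, IsClosedForm.isFormOf_operator _, isDirichletForm_sumForm hV⟩

open Ell2

variable {X : Type*} {μ : Weight X} {G : WeightedGraph X} {V : X → ℝ}

/-! ### The formal operator represents the form of a Markovian realization -/

/-- The constant `∑ y, b x y + V x * μ x`. -/
noncomputable def diagonal (G : WeightedGraph X) (μ : Weight X) (V : X → ℝ) (x : X) : ℝ :=
  ∑' y, G.b x y + V x * μ x

theorem summable_mul_of_mem {f : X → ℝ} (hf : f ∈ formalDomain G) (x : X) :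
    Summable (fun y => G.b x y * f y) := by
  refine Summable.of_norm_bounded (hf x) (fun y => ?_)
  rw [Real.norm_eq_abs, abs_mul, abs_of_nonneg (G.nonneg x y)]

theorem mul_formalOperator_eq {f : X → ℝ} (hf : f ∈ formalDomain G) (x : X) :
    μ x * formalOperator G μ V f x = diagonal G μ V x * f x - ∑' y, G.b x y * f y := by
  rw [mul_formalOperator, diagonal]
  have h : ∑' y, G.b x y * (f x - f y) = (∑' y, G.b x y) * f x - ∑' y, G.b x y * f y := by
    rw [← tsum_mul_right, ← ((G.summable x).mul_right (f x)).tsum_sub (summable_mul_of_mem hf x)]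
    exact tsum_congr (fun y => by ring)
  rw [h]
  ring

theorem isNormalContraction_abs : IsNormalContraction (fun t => |t|) :=
  ⟨abs_zero, fun s t => abs_abs_sub_abs_le s t⟩

theorem isNormalContraction_min {s : ℝ} (hs : 0 ≤ s) : IsNormalContraction (fun t => min t s) :=
  ⟨min_eq_left hs, fun a b => by
    simpa using abs_min_sub_min_le_max a s b s⟩

variable {q : Ell2 μ → EReal} {H : Ell2 μ →ₗ.[ℝ] Ell2 μ}

theorem IsDirichletForm.toReal_contraction_le (hD : IsDirichletForm q) {C : ℝ → ℝ}
    (hC : IsNormalContraction C) {f : Ell2 μ} (hf : f ∈ formDomain q) :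
    (q (Ell2.comp C hC.abs_le f)).toReal ≤ (q f).toReal :=
  EReal.toReal_le_toReal (hD.contraction C hC f hf).2 (hD.closed.isQuadraticForm.ne_bot _) hf

theorem IsRealization.finSupp_le (hH : IsRealization G μ V H) (hq : IsFormOf q H) (f : Ell2 μ)
    (hf : f ∈ finSuppSubmodule μ) : f ∈ formDomain q := by
  obtain ⟨q', hq', h⟩ := hH.finSupp_subset
  rw [hq.unique hq']
  exact h hf

theorem IsRealization.polarForm_delta (hH : IsRealization G μ V H) (hq : IsFormOf q H)
    {f : Ell2 μ} (hf : f ∈ H.domain) (x : X) :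
    polarForm q f (delta x) = μ x * formalOperator G μ V (fun y => f y) x := by
  rw [hq.polarForm_eq ⟨f, hf⟩ (hH.finSupp_le hq _ (delta_mem_finSupp x)), inner_delta,
    hH.apply_eq ⟨f, hf⟩, mul_comm]

/-- Nonnegative elements of the form domain are approximated by nonnegative elements of the domain
of the operator with smaller energy. -/
theorem IsDirichletForm.exists_approx (hD : IsDirichletForm q) (hq : IsFormOf q H) {f : Ell2 μ}
    (hf : f ∈ formDomain q) (hf0 : ∀ x, 0 ≤ f x) {α : ℝ} (hα : 1 ≤ α) :
    ∃ u ∈ H.domain, (∀ x, 0 ≤ u x) ∧ (q u).toReal ≤ (q f).toReal ∧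
      α * ‖u - f‖ ^ 2 ≤ (q f).toReal := by
  have hα0 : 0 < α := by linarith
  have hcl := hD.closed
  -- The approximant `u = α (H + α)⁻¹ f` is the unique minimizer of `v ↦ q v + α * ‖v - f‖ ^ 2`;
  -- `hmin` completes the square around it.
  obtain ⟨u, hu⟩ := hcl.exists_resolvent_mem (hcl.isShift_of_nonneg hD.nonneg hα) (α • f)
  have humem := hu.1
  have hmin : ∀ v ∈ formDomain q, (q v).toReal + α * ‖v - f‖ ^ 2
      = (q u).toReal + α * ‖u - f‖ ^ 2 + ((q (v - u)).toReal + α * ‖v - u‖ ^ 2) := by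
    intro v hv
    have hvu := hcl.isQuadraticForm.sub_mem hv humem
    have h1 := hcl.toReal_add humem hvu
    have h2 := hu.2 (v - u) hvu
    rw [add_sub_cancel] at h1
    rw [← smul_sub, real_inner_smul_left] at h2
    have h3 := norm_sub_sq_real (v - u) (f - u)
    rw [sub_sub_sub_cancel_right, real_inner_comm, norm_sub_rev f u] at h3
    rw [h1, h2, h3]
    ring
  have hnonneg : ∀ g, 0 ≤ (q g).toReal := fun g => EReal.toReal_nonneg (hD.nonneg g)
  refine ⟨u, ?_, ?_, ?_, ?_⟩
  · rw [LinearPMap.mem_domain_iff, hq.operator_eq]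
    exact ⟨_, by rw [hcl.operator_graph]; exact hu⟩
  -- Since `f ≥ 0`, the competitor `|u|` does at least as well as `u`, so it equals the minimizer.
  · set v := Ell2.comp _ isNormalContraction_abs.abs_le u with hv
    have hvmem := (hD.contraction _ isNormalContraction_abs u humem).1
    have h1 := hD.toReal_contraction_le isNormalContraction_abs humem
    have h2 : ‖v - f‖ ≤ ‖u - f‖ := by
      have h3 := norm_comp_sub_le isNormalContraction_abs u f
      have h4 : Ell2.comp _ isNormalContraction_abs.abs_le f = f := by
        ext x
        exact abs_of_nonneg (hf0 x)
      rwa [h4] at h3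
    have h3 := hmin v hvmem
    have h4 : ‖v - f‖ ^ 2 ≤ ‖u - f‖ ^ 2 := by gcongr
    have h5 : α * ‖v - f‖ ^ 2 ≤ α * ‖u - f‖ ^ 2 := by gcongr
    have h6 := hnonneg (v - u)
    have h7 : α * ‖v - u‖ ^ 2 ≤ 0 := by linarith
    have h8 : ‖v - u‖ ^ 2 = 0 := le_antisymm (nonpos_of_mul_nonpos_right h7 hα0) (sq_nonneg _)
    have h9 : v = u := sub_eq_zero.1 (norm_eq_zero.1 ((pow_eq_zero_iff two_ne_zero).1 h8))
    intro x
    rw [← h9]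
    exact abs_nonneg (u x)
  · have h1 := hmin f hf
    have h2 := hnonneg (f - u)
    have h3 : 0 ≤ α * ‖u - f‖ ^ 2 := by positivity
    have h4 : 0 ≤ α * ‖f - u‖ ^ 2 := by positivity
    rw [sub_self, norm_zero] at h1
    linarith
  · have h1 := hmin f hf
    have h2 := hnonneg (f - u)
    have h3 := hnonneg u
    have h4 : 0 ≤ α * ‖f - u‖ ^ 2 := by positivity
    rw [sub_self, norm_zero] at h1
    linarith

section Markovian

variable (hH : IsRealization G μ V H) (hq : IsFormOf q H) (hD : IsDirichletForm q)
include hH hq hD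

theorem abs_polarForm_delta_le {f : Ell2 μ} (hf : f ∈ formDomain q) (x : X) :
    |polarForm q f (delta x)| ≤ √(q f).toReal * √(q (delta x)).toReal := by
  rw [← Real.sqrt_mul (EReal.toReal_nonneg (hD.nonneg f))]
  exact Real.abs_le_sqrt (hD.closed.polarForm_sq_le hD.nonneg hf
    (hH.finSupp_le hq _ (delta_mem_finSupp x)))

/-- For nonnegative `u` in the operator domain, finite partial sums are at most `∑' y, b x y * u y =
diagonal * u x - q(u, delta x)`, and Cauchy–Schwarz bounds the last term. The bound uses `u` only
through finitely many values and through `q u ≤ q f`, so it passes to the limit `f`. -/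
theorem sum_mul_le_of_nonneg {f : Ell2 μ} (hf : f ∈ formDomain q) (hf0 : ∀ x, 0 ≤ f x) (x : X)
    (s : Finset X) : ∑ y ∈ s, G.b x y * f y
      ≤ diagonal G μ V x * f x + √(q f).toReal * √(q (delta x)).toReal := by
  have h1 : ∀ n : ℕ, ∃ u ∈ H.domain, (∀ x, 0 ≤ u x) ∧ (q u).toReal ≤ (q f).toReal ∧
      ((n : ℝ) + 1) * ‖u - f‖ ^ 2 ≤ (q f).toReal := fun n =>
    hD.exists_approx hq hf hf0 (by linarith [n.cast_nonneg (α := ℝ)])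
  choose u hu hu0 huq hun using h1
  have hlim : Tendsto u atTop (𝓝 f) := by
    have h2 : Tendsto (fun n => ‖u n - f‖ ^ 2) atTop (𝓝 0) := by
      have h3 := tendsto_one_div_add_atTop_nhds_zero_nat.const_mul (q f).toReal
      rw [mul_zero] at h3
      refine squeeze_zero (fun n => sq_nonneg _) (fun n => ?_) h3
      have h4 : (0 : ℝ) < (n : ℝ) + 1 := by positivity
      rw [mul_one_div, le_div_iff₀ h4, mul_comm]
      exact hun n
    rw [tendsto_iff_norm_sub_tendsto_zero]
    simpa [Real.sqrt_sq] using h2.sqrt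
  have hbound : ∀ n, ∑ y ∈ s, G.b x y * u n y
      ≤ diagonal G μ V x * u n x + √(q f).toReal * √(q (delta x)).toReal := by
    intro n
    have hF := hH.mem_formalDomain ⟨u n, hu n⟩
    have h2 := hH.polarForm_delta hq (hu n) x
    rw [mul_formalOperator_eq hF] at h2
    have h3 := (summable_mul_of_mem hF x).sum_le_tsum s
      (fun y _ => mul_nonneg (G.nonneg x y) (hu0 n y))
    have h4 := abs_polarForm_delta_le hH hq hD (hq.mem_of_mem_domain (hu n)) x
    have h5 : √(q (u n)).toReal * √(q (delta x)).toReal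
        ≤ √(q f).toReal * √(q (delta x)).toReal := by
      have := Real.sqrt_le_sqrt (huq n)
      gcongr
    have h6 := neg_abs_le (polarForm q (u n) (delta x))
    linarith
  exact le_of_tendsto_of_tendsto'
    (tendsto_finsetSum _ (fun y _ => (tendsto_apply hlim y).const_mul _))
    (((tendsto_apply hlim x).const_mul _).add_const _) hbound

theorem sum_mul_abs_le {f : Ell2 μ} (hf : f ∈ formDomain q) (x : X) (s : Finset X) :
    ∑ y ∈ s, G.b x y * |f y|
      ≤ |diagonal G μ V x| * |f x| + √(q f).toReal * √(q (delta x)).toReal := by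
  have h1 := sum_mul_le_of_nonneg hH hq hD (hD.contraction _ isNormalContraction_abs f hf).1
    (fun x => abs_nonneg _) x s
  have h2 := Real.sqrt_le_sqrt (hD.toReal_contraction_le isNormalContraction_abs hf)
  refine h1.trans (add_le_add ?_ ?_)
  · exact mul_le_mul_of_nonneg_right (le_abs_self _) (abs_nonneg _)
  · exact mul_le_mul_of_nonneg_right h2 (Real.sqrt_nonneg _)

theorem mem_formalDomain_of_mem_formDomain {f : Ell2 μ} (hf : f ∈ formDomain q) :
    (fun y => f y) ∈ formalDomain G := fun x =>
  summable_of_sum_le (fun y => mul_nonneg (G.nonneg x y) (abs_nonneg _))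
    (sum_mul_abs_le hH hq hD hf x)

theorem abs_tsum_mul_le {f : Ell2 μ} (hf : f ∈ formDomain q) (x : X) :
    |∑' y, G.b x y * f y|
      ≤ |diagonal G μ V x| * |f x| + √(q f).toReal * √(q (delta x)).toReal := by
  have hF := mem_formalDomain_of_mem_formDomain hH hq hD hf
  have h1 : ∀ y, ‖G.b x y * f y‖ = G.b x y * |f y| := fun y => by
    rw [Real.norm_eq_abs, abs_mul, abs_of_nonneg (G.nonneg x y)]
  have h2 := norm_tsum_le_tsum_norm ((hF x).congr (fun y => (h1 y).symm))
  simp only [h1] at h2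
  exact h2.trans ((hF x).tsum_le_of_sum_le (sum_mul_abs_le hH hq hD hf x))

/-- The identity holds on the operator domain, which is dense in the form norm, and both sides are
continuous for that norm; for the infinite sum this is `abs_tsum_mul_le`. -/
theorem polarForm_delta_eq {f : Ell2 μ} (hf : f ∈ formDomain q) (x : X) :
    polarForm q f (delta x) = diagonal G μ V x * f x - ∑' y, G.b x y * f y := by
  have hcl := hD.closed
  have hx := hH.finSupp_le hq _ (delta_mem_finSupp x)
  have hF := mem_formalDomain_of_mem_formDomain hH hq hD hf
  obtain ⟨u, hu, h1, h2⟩ := hq.exists_tendsto hf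
  have hbound : ∀ n, |polarForm q f (delta x) - (diagonal G μ V x * f x - ∑' y, G.b x y * f y)|
      ≤ 2 * (|diagonal G μ V x| * |(u n - f) x|
        + √(q (u n - f)).toReal * √(q (delta x)).toReal) := by
    intro n
    have hun := hq.mem_of_mem_domain (hu n)
    have hd := hcl.isQuadraticForm.sub_mem hun hf
    have hFn := hH.mem_formalDomain ⟨u n, hu n⟩
    have h3 := hH.polarForm_delta hq (hu n) x
    rw [mul_formalOperator_eq hFn] at h3
    have h4 := hcl.polarForm_sub_left hun hf hx
    have h5 : ∑' y, G.b x y * (u n - f) y = ∑' y, G.b x y * u n y - ∑' y, G.b x y * f y := by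
      rw [← (summable_mul_of_mem hFn x).tsum_sub (summable_mul_of_mem hF x)]
      exact tsum_congr (fun y => by rw [sub_apply]; ring)
    have h6 := abs_tsum_mul_le hH hq hD hd x
    have h7 := abs_polarForm_delta_le hH hq hD hd x
    have h8 : polarForm q f (delta x) - (diagonal G μ V x * f x - ∑' y, G.b x y * f y)
        = diagonal G μ V x * (u n - f) x - polarForm q (u n - f) (delta x)
          - ∑' y, G.b x y * (u n - f) y := by
      rw [h4, h5, h3, sub_apply]
      ring
    rw [h8]
    have h9 := abs_sub (diagonal G μ V x * (u n - f) x - polarForm q (u n - f) (delta x))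
      (∑' y, G.b x y * (u n - f) y)
    have h10 := abs_sub (diagonal G μ V x * (u n - f) x) (polarForm q (u n - f) (delta x))
    rw [abs_mul] at h10
    linarith
  have hlim : Tendsto (fun n => 2 * (|diagonal G μ V x| * |(u n - f) x|
        + √(q (u n - f)).toReal * √(q (delta x)).toReal)) atTop (𝓝 0) := by
    have h3 : Tendsto (fun n => |(u n - f) x|) atTop (𝓝 0) := by
      have := ((tendsto_apply h1 x).sub_const (f x)).abs
      simpa [sub_apply] using this
    have h4 : Tendsto (fun n => √(q (u n - f)).toReal) atTop (𝓝 0) := by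
      have := ((EReal.tendsto_toReal EReal.zero_ne_top EReal.zero_ne_bot).comp h2).sqrt
      simpa using this
    simpa using ((h3.const_mul |diagonal G μ V x|).add (h4.mul_const _)).const_mul 2
  have h3 := ge_of_tendsto' hlim hbound
  exact sub_eq_zero.1 (abs_eq_zero.1 (le_antisymm h3 (abs_nonneg _)))

/-! ### Nonnegativity of the potential -/

/-- For `x ∈ s`, cutting `1_s + ε δ_x` at height `1` returns `1_s`, so the energy cannot decrease to
first order in `ε`: `q(1_s, δ_x) ≥ 0`. This quantity is `diagonal - ∑ y ∈ s, b x y`, which tends to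
`V x * μ x` as `s` exhausts `X`. -/
theorem potential_nonneg (x : X) : 0 ≤ V x := by
  classical
  have hcl := hD.closed
  have hx := hH.finSupp_le hq _ (delta_mem_finSupp x)
  have key : ∀ s : Finset X, x ∈ s → ∑ y ∈ s, G.b x y ≤ diagonal G μ V x := by
    intro s hs
    have hsm := hH.finSupp_le hq _ (indicator_mem_finSupp s)
    have h1 := polarForm_delta_eq hH hq hD hsm x
    rw [tsum_eq_sum (s := s) (fun y hy => by simp [indicator_apply, hy]),
      Finset.sum_congr rfl (g := fun y => G.b x y) (fun y hy => by simp [indicator_apply, hy]),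
      indicator_apply, if_pos hs, mul_one] at h1
    have h2 : ∀ ε : ℝ, 0 < ε → 0 ≤ 2 * polarForm q (indicator s) (delta x)
        + ε * (q (delta x)).toReal := by
      intro ε hε
      have h3 := hD.toReal_contraction_le (isNormalContraction_min zero_le_one)
        (hcl.isQuadraticForm.add_mem hsm (hcl.isQuadraticForm.smul_mem ε hx))
      have h4 : Ell2.comp _ (isNormalContraction_min zero_le_one).abs_le
          (indicator s + ε • delta x : Ell2 μ) = indicator s := by
        ext y
        change min ((indicator s + ε • delta x : Ell2 μ) y) 1 = (indicator s : Ell2 μ) y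
        rw [add_apply, smul_apply, delta_apply, indicator_apply]
        split_ifs with e1 e2 e2
        · rw [min_eq_right]
          linarith
        · simp
        · exact absurd (e2 ▸ hs) e1
        · simp
      rw [h4, hcl.toReal_add hsm (hcl.isQuadraticForm.smul_mem ε hx),
        hcl.polarForm_smul_right ε hsm hx, hcl.isQuadraticForm.toReal_smul] at h3
      have h5 : 0 ≤ ε * (2 * polarForm q (indicator s) (delta x)
        + ε * (q (delta x)).toReal) := by linarith
      exact nonneg_of_mul_nonneg_right h5 hε
    have h3 : Tendsto (fun ε : ℝ => 2 * polarForm q (indicator s) (delta x)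
        + ε * (q (delta x)).toReal) (𝓝[>] 0)
        (𝓝 (2 * polarForm q (indicator s) (delta x) + 0 * (q (delta x)).toReal)) :=
      Tendsto.mono_left ((continuous_const.add (continuous_id.mul continuous_const)).tendsto 0)
        nhdsWithin_le_nhds
    have h4 := ge_of_tendsto h3 (eventually_mem_nhdsWithin.mono h2)
    linarith
  have h1 : ∑' y, G.b x y ≤ diagonal G μ V x := by
    refine le_of_tendsto (G.summable x).hasSum ?_
    filter_upwards [eventually_ge_atTop {x}] with s hs
    exact key s (hs (Finset.mem_singleton_self x))
  rw [diagonal] at h1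
  exact nonneg_of_mul_nonneg_left (by linarith) (μ.pos x)

/-! ### The form of a Markovian realization dominates the Schrödinger form -/

theorem polarForm_indicator {g : Ell2 μ} (hg : g ∈ formDomain q) {K : Finset X}
    (hgK : ∀ x ∈ K, g x = 0) :
    polarForm q g (indicator K) = -∑ x ∈ K, ∑' y, G.b x y * g y := by
  have h1 := hD.closed.polarForm_sum_left K (fun _ => 1) (fun x => (delta x : Ell2 μ))
    (fun x => hH.finSupp_le hq _ (delta_mem_finSupp x)) hg
  simp only [one_smul, one_mul] at h1
  rw [← indicator_eq_sum] at h1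
  rw [hD.closed.polarForm_comm, h1, ← Finset.sum_neg_distrib]
  refine Finset.sum_congr rfl (fun x hx => ?_)
  rw [hD.closed.polarForm_comm, polarForm_delta_eq hH hq hD hg, hgK x hx]
  ring

/-- The growth of the energy of the truncations of a function that vanishes on `K`. -/
theorem toReal_truncation_le {r : Ell2 μ} (hr : r ∈ formDomain q) {K : Finset X}
    (hrK : ∀ x ∈ K, r x = 0) (L : Finset X) {s t : ℝ} (hs : 0 ≤ s) (hst : s ≤ t) :
    (q (Ell2.comp _ (isNormalContraction_min hs).abs_le r)).toReal
      + 2 * s * ∑ y ∈ L, (∑ x ∈ K, G.b x y) * (min (r y) t - min (r y) s)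
      ≤ (q (Ell2.comp _ (isNormalContraction_min (hs.trans hst)).abs_le r)).toReal := by
  classical
  have hcl := hD.closed
  set rs := Ell2.comp _ (isNormalContraction_min hs).abs_le r with hrs
  set rt := Ell2.comp _ (isNormalContraction_min (hs.trans hst)).abs_le r with hrt
  have hrs' : ∀ y, rs y = min (r y) s := fun _ => rfl
  have hrt' : ∀ y, rt y = min (r y) t := fun _ => rfl
  have hrsm : rs ∈ formDomain q := (hD.contraction _ (isNormalContraction_min hs) r hr).1
  have hrtm : rt ∈ formDomain q :=
    (hD.contraction _ (isNormalContraction_min (hs.trans hst)) r hr).1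
  have hKm := hH.finSupp_le hq _ (indicator_mem_finSupp K)
  have hsKm := hcl.isQuadraticForm.smul_mem s hKm
  -- Raising the function to `s` on `K`, where it vanishes, makes the cut at `s` act only off `K`.
  -- When the two energies are compared, the contributions of `s • indicator K` alone cancel,
  -- leaving `q rs` and `q rt` with their cross terms.
  have hcomp : Ell2.comp _ (isNormalContraction_min hs).abs_le (rt + s • indicator K)
      = rs + s • indicator K := by
    ext y
    change min ((rt + s • indicator K : Ell2 μ) y) s = _
    rw [add_apply, add_apply, smul_apply, hrs', hrt', indicator_apply]
    split_ifs with hy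
    · rw [hrK y hy, min_eq_left hs, min_eq_left (hs.trans hst)]
      simp
    · simp [min_assoc, min_eq_right hst]
  have h1 := hD.toReal_contraction_le (isNormalContraction_min hs)
    (hcl.isQuadraticForm.add_mem hrtm hsKm)
  rw [hcomp, hcl.toReal_add hrsm hsKm, hcl.toReal_add hrtm hsKm, hcl.polarForm_smul_right s hrsm hKm,
    hcl.polarForm_smul_right s hrtm hKm] at h1
  have h2 := hcl.polarForm_sub_left hrtm hrsm hKm
  have hd := hcl.isQuadraticForm.sub_mem hrtm hrsm
  have h3 := polarForm_indicator hH hq hD hd (K := K) (fun x hx => by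
    rw [sub_apply, hrs', hrt', hrK x hx, min_eq_left hs, min_eq_left (hs.trans hst), sub_zero])
  have h4 : ∑ y ∈ L, (∑ x ∈ K, G.b x y) * (min (r y) t - min (r y) s)
      ≤ ∑ x ∈ K, ∑' y, G.b x y * (rt - rs) y := by
    simp only [Finset.sum_mul]
    rw [Finset.sum_comm]
    refine Finset.sum_le_sum (fun x _ => ?_)
    exact (summable_mul_of_mem (mem_formalDomain_of_mem_formDomain hH hq hD hd) x).sum_le_tsum L
      (fun y _ => mul_nonneg (G.nonneg x y)
        (sub_nonneg.2 (min_le_min_left _ hst)))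
  have h5 : s * ∑ y ∈ L, (∑ x ∈ K, G.b x y) * (min (r y) t - min (r y) s)
      ≤ s * ∑ x ∈ K, ∑' y, G.b x y * (rt - rs) y := by gcongr
  have h6 : s * (polarForm q rt (indicator K) - polarForm q rs (indicator K))
      = -(s * ∑ x ∈ K, ∑' y, G.b x y * (rt - rs) y) := by
    rw [← h2, h3]
    ring
  linarith

/-- A discrete version of `r ^ 2 = ∫₀^r 2 s ds`: the truncation estimate is summed over heights `0,
ε, 2ε, …`. -/
theorem sum_sq_le_of_nonneg {r : Ell2 μ} (hr : r ∈ formDomain q) (hr0 : ∀ x, 0 ≤ r x)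
    {K : Finset X} (hrK : ∀ x ∈ K, r x = 0) (L : Finset X) :
    ∑ y ∈ L, (∑ x ∈ K, G.b x y) * r y ^ 2 ≤ (q r).toReal := by
  set β : X → ℝ := fun y => ∑ x ∈ K, G.b x y with hβ
  have hβ0 : ∀ y, 0 ≤ β y := fun y => Finset.sum_nonneg (fun x _ => G.nonneg x y)
  -- Each step replaces `a' ^ 2 - a ^ 2` by `2 s (a' - a)`, where `a ≤ s` and `a' - a ≤ ε`; the
  -- error is at most `ε ^ 2`, which accumulates to `k * ε ^ 2`.
  have key : ∀ (ε : ℝ) (hε : 0 ≤ ε) (k : ℕ), ∑ y ∈ L, β y * min (r y) (k * ε) ^ 2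
      - (∑ y ∈ L, β y) * (k * ε ^ 2) ≤ (q (Ell2.comp _ (isNormalContraction_min
        (mul_nonneg (Nat.cast_nonneg (α := ℝ) k) hε)).abs_le r)).toReal := by
    intro ε hε k
    induction k with
    | zero =>
      have h1 : ∀ y ∈ L, β y * min (r y) (((0 : ℕ) : ℝ) * ε) ^ 2 = 0 := fun y _ => by
        rw [Nat.cast_zero, zero_mul, min_eq_right (hr0 y)]
        ring
      rw [Finset.sum_eq_zero h1]
      simp only [Nat.cast_zero, zero_mul, mul_zero, sub_zero]
      exact EReal.toReal_nonneg (hD.nonneg _)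
    | succ k ih =>
      have hk : 0 ≤ (k : ℝ) * ε := mul_nonneg (Nat.cast_nonneg k) hε
      have hle : (k : ℝ) * ε ≤ ((k + 1 : ℕ) : ℝ) * ε := by
        push_cast
        linarith
      have h1 := toReal_truncation_le hH hq hD hr hrK L hk hle
      have h2 : ∑ y ∈ L, β y * min (r y) (((k + 1 : ℕ) : ℝ) * ε) ^ 2
          ≤ ∑ y ∈ L, β y * min (r y) (k * ε) ^ 2 + 2 * (k * ε) * ∑ y ∈ L, β y *
            (min (r y) (((k + 1 : ℕ) : ℝ) * ε) - min (r y) (k * ε))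
            + (∑ y ∈ L, β y) * ε ^ 2 := by
        rw [Finset.mul_sum, Finset.sum_mul, ← Finset.sum_add_distrib, ← Finset.sum_add_distrib]
        refine Finset.sum_le_sum (fun y _ => ?_)
        have h3 : min (r y) (((k + 1 : ℕ) : ℝ) * ε) ^ 2 ≤ min (r y) (k * ε) ^ 2 + 2 * (k * ε) *
            (min (r y) (((k + 1 : ℕ) : ℝ) * ε) - min (r y) (k * ε)) + ε ^ 2 := by
          have e1 : min (r y) (k * ε) ≤ k * ε := min_le_right _ _
          have e2 : min (r y) (k * ε) ≤ min (r y) (((k + 1 : ℕ) : ℝ) * ε) := min_le_min_left _ hle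
          have e3 : min (r y) (((k + 1 : ℕ) : ℝ) * ε) ≤ min (r y) (k * ε) + ε := by
            rw [← min_add_add_right]
            refine min_le_min (by linarith) (by push_cast; linarith)
          nlinarith [mul_nonneg (sub_nonneg.2 e1) (sub_nonneg.2 e2)]
        have h4 := mul_le_mul_of_nonneg_left h3 (hβ0 y)
        linarith
      have h3 : (∑ y ∈ L, β y) * (((k + 1 : ℕ) : ℝ) * ε ^ 2)
          = (∑ y ∈ L, β y) * (k * ε ^ 2) + (∑ y ∈ L, β y) * ε ^ 2 := by
        push_cast
        ring
      rw [h3]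
      linarith
  -- The number `S` bounds every `r y` with `y ∈ L`, so truncation at `S` changes nothing on `L`.
  -- With `n + 1` steps of size `S / (n + 1)` the total error is of order `1 / (n + 1)`.
  set S := ∑ y ∈ L, r y with hS
  have hS0 : 0 ≤ S := Finset.sum_nonneg (fun y _ => hr0 y)
  have hbound : ∀ n : ℕ, ∑ y ∈ L, β y * r y ^ 2
      ≤ (q r).toReal + (∑ y ∈ L, β y) * S ^ 2 * (1 / ((n : ℝ) + 1)) := by
    intro n
    have hn : (0 : ℝ) < (n : ℝ) + 1 := by positivity
    have h1 := key (S / ((n : ℝ) + 1)) (by positivity) (n + 1)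
    have h2 : ((n + 1 : ℕ) : ℝ) * (S / ((n : ℝ) + 1)) = S := by
      push_cast
      field_simp
    have h3 : ((n + 1 : ℕ) : ℝ) * (S / ((n : ℝ) + 1)) ^ 2 = S ^ 2 * (1 / ((n : ℝ) + 1)) := by
      push_cast
      field_simp
    have h4 := hD.toReal_contraction_le (isNormalContraction_min
        (mul_nonneg (Nat.cast_nonneg (α := ℝ) (n + 1)) (div_nonneg hS0 hn.le))) hr
    rw [h3] at h1
    have h5 : ∑ y ∈ L, β y * min (r y) (((n + 1 : ℕ) : ℝ) * (S / ((n : ℝ) + 1))) ^ 2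
        = ∑ y ∈ L, β y * r y ^ 2 := by
      refine Finset.sum_congr rfl (fun y hy => ?_)
      rw [h2, min_eq_left (Finset.single_le_sum (f := fun y => r y) (fun y _ => hr0 y) hy)]
    rw [h5] at h1
    linarith
  have hlim := (tendsto_one_div_add_atTop_nhds_zero_nat (𝕜 := ℝ)).const_mul
    ((∑ y ∈ L, β y) * S ^ 2) |>.const_add (q r).toReal
  rw [mul_zero, add_zero] at hlim
  exact ge_of_tendsto' hlim hbound

theorem sum_sq_le {r : Ell2 μ} (hr : r ∈ formDomain q)
    {K : Finset X} (hrK : ∀ x ∈ K, r x = 0) (L : Finset X) :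
    ∑ y ∈ L, (∑ x ∈ K, G.b x y) * r y ^ 2 ≤ (q r).toReal := by
  have h1 := sum_sq_le_of_nonneg hH hq hD (hD.contraction _ isNormalContraction_abs r hr).1
    (fun x => abs_nonneg _) (K := K) (fun x hx => by
      change |r x| = 0
      rw [hrK x hx, abs_zero]) L
  refine le_trans (le_of_eq ?_) (h1.trans (hD.toReal_contraction_le isNormalContraction_abs hr))
  refine Finset.sum_congr rfl (fun y _ => ?_)
  change _ = _ * |r y| ^ 2
  rw [sq_abs]

/-- Write `f = r + φ` with `φ = f 1_K`, so that `q f = q r + q(φ, r) + q(φ, f)`. The last two terms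
are explicit because `φ` is a combination of point masses, and `sum_sq_le` bounds `q r` below by
precisely the squares needed to complete `b x y * (f x - f y) ^ 2` for edges leaving `K`. -/
theorem energy_le {f : Ell2 μ} (hf : f ∈ formDomain q) (K : Finset X) :
    1 / 2 * ∑ x ∈ K, ∑ y ∈ K, G.b x y * (f x - f y) ^ 2 + ∑ x ∈ K, V x * f x ^ 2 * μ x
      ≤ (q f).toReal := by
  classical
  have hcl := hD.closed
  have hδ : ∀ x, delta x ∈ formDomain q := fun x => hH.finSupp_le hq _ (delta_mem_finSupp x)
  set φ : Ell2 μ := ∑ x ∈ K, f x • delta x with hφ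
  have hφm : φ ∈ formDomain q := hH.finSupp_le hq _
    (Submodule.sum_mem _ (fun x _ => Submodule.smul_mem _ _ (delta_mem_finSupp x)))
  have hφa : ∀ y, φ y = if y ∈ K then f y else 0 := by
    intro y
    simp [hφ, sum_apply, smul_apply, delta_apply]
  set r := f - φ with hr
  have hrm : r ∈ formDomain q := hcl.isQuadraticForm.sub_mem hf hφm
  have hra : ∀ y, r y = if y ∈ K then 0 else f y := by
    intro y
    rw [hr, sub_apply, hφa]
    split_ifs <;> simp
  have hrK : ∀ x ∈ K, r x = 0 := fun x hx => by rw [hra, if_pos hx]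
  have hFf := mem_formalDomain_of_mem_formDomain hH hq hD hf
  have hFr := mem_formalDomain_of_mem_formDomain hH hq hD hrm
  have hsr : ∀ x ∈ K, Summable (fun y => G.b x y * r y ^ 2) := by
    intro x hx
    refine summable_of_sum_le (c := (q r).toReal)
      (fun y => mul_nonneg (G.nonneg x y) (sq_nonneg _)) (fun L => ?_)
    refine le_trans (Finset.sum_le_sum (fun y _ => ?_)) (sum_sq_le hH hq hD hrm hrK L)
    refine mul_le_mul_of_nonneg_right ?_ (sq_nonneg _)
    exact Finset.single_le_sum (f := fun x => G.b x y) (fun x _ => G.nonneg x y) hx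
  have h1 : ∑ x ∈ K, ∑' y, G.b x y * r y ^ 2 ≤ (q r).toReal := by
    rw [← Summable.tsum_finsetSum hsr]
    refine (summable_sum hsr).tsum_le_of_sum_le (fun L => ?_)
    refine le_trans (le_of_eq ?_) (sum_sq_le hH hq hD hrm hrK L)
    exact Finset.sum_congr rfl (fun y _ => (Finset.sum_mul _ _ _).symm)
  have h2 : (q f).toReal = (q r).toReal + ∑ x ∈ K, f x * (diagonal G μ V x * f x
      - (∑' y, G.b x y * r y + ∑' y, G.b x y * f y)) := by
    have e1 : (q f).toReal = (q r).toReal + polarForm q φ r + polarForm q φ f := by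
      have e2 := hcl.toReal_add hrm hφm
      rw [hr, sub_add_cancel, ← hr, hcl.polarForm_comm] at e2
      have e3 : f = r + φ := by rw [hr, sub_add_cancel]
      have e4 := hcl.polarForm_add_right hφm hrm hφm
      rw [← e3, hcl.polarForm_self] at e4
      linarith
    rw [e1, hφ, hcl.polarForm_sum_left K _ _ hδ hrm, hcl.polarForm_sum_left K _ _ hδ hf, add_assoc,
      ← Finset.sum_add_distrib]
    congr 1
    refine Finset.sum_congr rfl (fun x hx => ?_)
    rw [hcl.polarForm_comm, polarForm_delta_eq hH hq hD hrm, hcl.polarForm_comm,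
      polarForm_delta_eq hH hq hD hf, hrK x hx]
    ring
  have h3 : ∀ x ∈ K, ∑ y ∈ K, G.b x y * (f x ^ 2 - f x * f y) + V x * f x ^ 2 * μ x
      ≤ ∑' y, G.b x y * r y ^ 2 + f x * (diagonal G μ V x * f x
      - (∑' y, G.b x y * r y + ∑' y, G.b x y * f y)) := by
    intro x hx
    have hsum := (((hsr x hx).hasSum.add ((G.summable x).hasSum.mul_right (f x ^ 2))).sub
      ((summable_mul_of_mem hFr x).hasSum.mul_left (f x))).sub
      ((summable_mul_of_mem hFf x).hasSum.mul_left (f x))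
    -- For `y ∉ K` one has `r y = f y`, and the summand is `b x y * (f x - f y) ^ 2`; these edges
    -- are discarded.
    have e1 : ∀ y ∉ K, 0 ≤ G.b x y * r y ^ 2 + G.b x y * f x ^ 2 - f x * (G.b x y * r y)
        - f x * (G.b x y * f y) := by
      intro y hy
      rw [hra, if_neg hy]
      have := mul_nonneg (G.nonneg x y) (sq_nonneg (f x - f y))
      linarith
    have e2 := sum_le_hasSum K e1 hsum
    have e3 : ∑ y ∈ K, (G.b x y * r y ^ 2 + G.b x y * f x ^ 2 - f x * (G.b x y * r y)
        - f x * (G.b x y * f y)) = ∑ y ∈ K, G.b x y * (f x ^ 2 - f x * f y) := by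
      refine Finset.sum_congr rfl (fun y hy => ?_)
      rw [hrK y hy]
      ring
    rw [e3] at e2
    rw [diagonal]
    linarith
  have h4 := Finset.sum_le_sum h3
  rw [Finset.sum_add_distrib, Finset.sum_add_distrib] at h4
  have h5 : 1 / 2 * ∑ x ∈ K, ∑ y ∈ K, G.b x y * (f x - f y) ^ 2
      = ∑ x ∈ K, ∑ y ∈ K, G.b x y * (f x ^ 2 - f x * f y) := by
    have e1 : ∑ x ∈ K, ∑ y ∈ K, G.b x y * (f x ^ 2 - f x * f y)
        = ∑ x ∈ K, ∑ y ∈ K, G.b x y * (f y ^ 2 - f x * f y) := by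
      rw [Finset.sum_comm]
      refine Finset.sum_congr rfl (fun x _ => Finset.sum_congr rfl (fun y _ => ?_))
      rw [G.symm y x]
      ring
    have e2 : ∑ x ∈ K, ∑ y ∈ K, G.b x y * (f x - f y) ^ 2
        = ∑ x ∈ K, ∑ y ∈ K, G.b x y * (f x ^ 2 - f x * f y)
          + ∑ x ∈ K, ∑ y ∈ K, G.b x y * (f y ^ 2 - f x * f y) := by
      simp only [← Finset.sum_add_distrib]
      refine Finset.sum_congr rfl (fun x _ => Finset.sum_congr rfl (fun y _ => ?_))
      ring
    rw [e2, ← e1]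
    ring
  rw [h5, h2]
  linarith

theorem mem_finiteEnergy_of_mem_formDomain {f : Ell2 μ} (hf : f ∈ formDomain q) :
    (fun x => f x) ∈ finiteEnergy G μ V := by
  classical
  have hV := potential_nonneg hH hq hD
  have hb : ∀ p : X × X, 0 ≤ G.b p.1 p.2 * (f p.1 - f p.2) ^ 2 := fun p =>
    mul_nonneg (G.nonneg _ _) (sq_nonneg _)
  have hp : ∀ x, 0 ≤ V x * f x ^ 2 * μ x := fun x =>
    mul_nonneg (mul_nonneg (hV x) (sq_nonneg _)) (μ.pos x).le
  constructor
  · refine summable_of_sum_le (c := 2 * (q f).toReal) hb (fun t => ?_)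
    -- A finite set containing both endpoints of every pair in `t`.
    set K := t.image Prod.fst ∪ t.image Prod.snd with hK
    have h1 : t ⊆ K ×ˢ K := by
      intro p hpt
      rw [Finset.mem_product]
      exact ⟨Finset.mem_union_left _ (Finset.mem_image_of_mem _ hpt),
        Finset.mem_union_right _ (Finset.mem_image_of_mem _ hpt)⟩
    have h2 := Finset.sum_le_sum_of_subset_of_nonneg h1 (fun p _ _ => hb p)
    rw [Finset.sum_product] at h2
    have h3 := energy_le hH hq hD hf K
    have h4 := Finset.sum_nonneg (s := K) (fun x _ => hp x)
    simp only at h2 ⊢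
    linarith
  · refine summable_of_sum_le (c := (q f).toReal) (fun x => by
      rw [abs_of_nonneg (hV x)]
      exact hp x) (fun K => ?_)
    have h3 := energy_le hH hq hD hf K
    have h4 : 0 ≤ ∑ x ∈ K, ∑ y ∈ K, G.b x y * (f x - f y) ^ 2 :=
      Finset.sum_nonneg (fun x _ => Finset.sum_nonneg (fun y _ => hb (x, y)))
    simp only [abs_of_nonneg (hV _)]
    linarith

/-! ### Comparison on finitely supported functions and uniqueness -/

theorem eq_sumForm_of_mem_finSupp {f : Ell2 μ} (hf : f ∈ finSuppSubmodule μ) :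
    q f = sumForm (gradient G μ V) f := by
  have hV := potential_nonneg hH hq hD
  have hs := isClosedForm_sumForm_gradient (G := G) (μ := μ) hV
  have hf1 := hH.finSupp_le hq f hf
  have hf2 := finSupp_le_formDomain (G := G) hV f hf
  obtain ⟨s, hfs⟩ := exists_eq_sum_delta hf
  have h1 := hD.closed.polarForm_sum_left s (fun x => f x) (fun x => (delta x : Ell2 μ))
    (fun x => hH.finSupp_le hq _ (delta_mem_finSupp x)) hf1
  have h2 := hs.polarForm_sum_left s (fun x => f x) (fun x => (delta x : Ell2 μ))
    (delta_mem_formDomain hV) hf2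
  rw [← hfs, hD.closed.polarForm_self] at h1
  rw [← hfs, hs.polarForm_self] at h2
  rw [← hD.closed.isQuadraticForm.coe_toReal hf1, ← hs.isQuadraticForm.coe_toReal hf2, h1, h2]
  congr 1
  refine Finset.sum_congr rfl (fun x _ => ?_)
  rw [hD.closed.polarForm_comm, hs.polarForm_comm, polarForm_delta hV hf2,
    polarForm_delta_eq hH hq hD hf1,
    mul_formalOperator_eq (mem_formalDomain_of_mem_formDomain hH hq hD hf1)]

/-- By closedness `q` extends `Q0`, since the two agree on finitely supported functions. The domain
of `q` lies in that of `QN = Q0`, so there is no room for a proper extension. -/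
theorem eq_Q0_of_Q0_eq_QN (h : Q0 G μ V = QN G μ V) : q = Q0 G μ V := by
  have hV := potential_nonneg hH hq hD
  have hs := isClosedForm_sumForm_gradient (G := G) (μ := μ) hV
  have hr := isFormRestriction_Q0 (G := G) (μ := μ) hV
  rw [h, QN_eq_sumForm hV] at hr ⊢
  ext f
  by_cases hf : f ∈ formDomain (sumForm (gradient G μ V))
  · obtain ⟨u, hu, v, hlim, rfl⟩ := (IsShift.mem_closure_iff _).1 (hr.mem_iff.1 hf)
    obtain ⟨h1, h2⟩ := FormSpace.tendsto_iff.1 hlim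
    exact (hs.eq_of_tendsto hD.closed (S := finSuppSubmodule μ) (fun g hg =>
      ⟨finSupp_le_formDomain hV g hg, hH.finSupp_le hq g hg,
        (eq_sumForm_of_mem_finSupp hH hq hD hg).symm⟩) hu hf h1 h2).2
  · have hf' : f ∉ formDomain q := fun h' => hf ((mem_sumForm_iff _).2
      ((mem_finiteEnergy_iff hV f).1 (mem_finiteEnergy_of_mem_formDomain hH hq hD h')))
    exact (not_not.1 hf').trans (not_not.1 hf).symm

end Markovian

end DiscreteSchrodinger

open DiscreteSchrodinger in
theorem mainTheorem11 {X : Type*} [Countable X] [Nonempty X]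
    (G : DiscreteSchrodinger.WeightedGraph X) (μ : DiscreteSchrodinger.Weight X) (V : X → ℝ) :
    (∃! H : DiscreteSchrodinger.Ell2 μ →ₗ.[ℝ] DiscreteSchrodinger.Ell2 μ,
        DiscreteSchrodinger.IsMarkovianRealization G μ V H) ↔
      (∀ x, 0 ≤ V x) ∧ DiscreteSchrodinger.Q0 G μ V = DiscreteSchrodinger.QN G μ V := by
  constructor
  · rintro ⟨H, ⟨hH, q, hq, hD⟩, huniq⟩
    have hV := potential_nonneg hH hq hD
    refine ⟨hV, ?_⟩
    -- Both extremal operators equal `H`, so the two forms belong to the same operator and coincide.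
    have h1 := huniq _ (isMarkovianRealization_Q0 hV)
    have h2 := huniq _ (isMarkovianRealization_QN hV)
    have h3 := (isClosedForm_Q0 (G := G) (μ := μ) hV).isFormOf_operator
    have h4 := (isClosedForm_sumForm_gradient (G := G) (μ := μ) hV).isFormOf_operator
    rw [h1] at h3
    rw [h2] at h4
    rw [QN_eq_sumForm hV]
    exact h3.unique h4
  · rintro ⟨hV, h⟩
    refine ⟨_, isMarkovianRealization_Q0 hV, ?_⟩
    rintro H ⟨hH, q, hq, hD⟩
    obtain rfl := eq_Q0_of_Q0_eq_QN hH hq hD h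
    exact hq.operator_eq
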